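/- Let $f$ and $g$ be probability densities on $\mathbb R$ with $f\in L^2(\mathbb R)$, let $h=g*f$, and let $Y_1,Y_2,\dots$ be i.i.d. random variables with density $h$. Write $\tilde u(t)=\int e^{-itx}u(x)\,dx$. Fix an integer $m\ge 1$ and, for $\alpha>0$, put $$\tilde\varphi_\alpha(t)=\frac{\overline{\tilde g(t)}}{|\tilde g(t)|^2+\alpha|t|^{2m}},\qquad \varphi_\alpha(x)=\frac1{2\pi}\int e^{itx}\tilde\varphi_\alpha(t)\,dt\quad(\text{inverse Fourier transform in }L^2),\qquad f_N^\alpha(x)=\frac1N\sum_{i=1}^N\varphi_\alpha(x-Y_i).$$ For $N\ge1$ let $R(\alpha,N)=2\pi\left(\mathbb E\int (f_N^\alpha(x)-f(x))^2\,dx-\int f(x)^2\,dx\right)$. For a sample $Y_1,\dots,Y_n$, $n\ge 2$, let $\tilde P_n(t)=\frac1n\sum_{j=1}^n e^{-itY_j}$, $\tilde H_n(t)=\frac n{n-1}\left(|\tilde P_n(t)|^2-\frac1n\right)$, and $$\hat R(\alpha,N)=\frac{N-1}{N}\int|\tilde\varphi_\alpha(t)|^2\tilde H_n(t)\,dt-2\int\frac{\tilde\varphi_\alpha(t)}{\overline{\tilde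 g(t)}}\tilde H_n(t)\,dt+\frac1N\int|\tilde\varphi_\alpha(t)|^2\,dt,$$ where the quotient $\tilde\varphi_\alpha(t)/\overline{\tilde g(t)}$ is read as $0$ at points with $\tilde g(t)=0$. Let $n_1=n_1(n)\ge 1$ be integers, and let $(b_N)$, $(r_N)$ be real sequences such that, for all large $n$, $b_{n_1}>0$, $r_{n_1}>0$, and $b_{n_1}\le M$ for some constant $M$. Suppose that $n^{-1}(r_{n_1}b_{n_1})^{-2}=O(n^{-q})$ as $n\to\infty$ for some $q>0$. Let $k_n=n^p$ for some $p>0$, and let $\alpha_i=\alpha_{n,i}$, for integers $1\le i\le k_n$, be deterministic penalties with $\iota b_{n_1}\le\alpha_i\le\lambda b_{n_1}$ for all large $n$, where $\iota>0$ and $\lambda$ are constants. Then, with probability $1$, $$\sup_{1\le i\le k_n}\left|\hat R(\alpha_i,n_1)-R(\alpha_i,n_1)\right|=o(r_{n_1})\qquad(n\to\infty).$$ -/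

import Mathlib

open MeasureTheory ProbabilityTheory Filter Topology Asymptotics
open scoped FourierTransform ComplexConjugate

noncomputable section

namespace SPeD

/-- `f` is a probability density function on the real line. -/
structure IsDensity (f : ℝ → ℝ) : Prop where
  measurable : Measurable f
  nonneg : ∀ x, 0 ≤ f x
  integral_eq_one : ∫ x, f x = 1

/-- The density `h = g * f` of `Y = X + E`, `h(y) = ∫ f(t) g(y - t) dt`. -/
def obsDensity (f g : ℝ → ℝ) (y : ℝ) : ℝ := ∫ t, f t * g (y - t)

/-- The Fourier transform `∫ e^{-itx} u(x) dx`, in the characteristic-function normalization. -/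
def ft (u : ℝ → ℝ) (t : ℝ) : ℂ := ∫ x : ℝ, Complex.exp (-(Complex.I * t * x)) * (u x : ℂ)

/-- `φ̃_α(t) = conj (g̃ t) / (|g̃ t|² + α |t|^{2m})`. -/
def filterFT (g : ℝ → ℝ) (m : ℕ) (α t : ℝ) : ℂ :=
  conj (ft g t) / ((‖ft g t‖ ^ 2 + α * |t| ^ (2 * m) : ℝ) : ℂ)

theorem continuous_ft {g : ℝ → ℝ} (hg : IsDensity g) : Continuous (ft g) := by
  have hi : Integrable g := by
    by_contra h
    have h1 := hg.integral_eq_one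
    rw [integral_undef h] at h1
    exact zero_ne_one h1
  refine continuous_of_dominated (bound := fun x => ‖g x‖) ?_ ?_ hi.norm ?_
  · intro t
    have hm := hg.measurable
    exact Measurable.aestronglyMeasurable (by fun_prop)
  · intro t
    refine Eventually.of_forall fun x => ?_
    have : ‖Complex.exp (-(Complex.I * t * x))‖ = 1 := by
      rw [Complex.norm_exp]; simp
    rw [norm_mul, this, one_mul, Complex.norm_real]
  · exact Eventually.of_forall fun x => by fun_prop

theorem ft_zero {g : ℝ → ℝ} (hg : IsDensity g) : ft g 0 = 1 := by
  have h : ft g 0 = ∫ x : ℝ, (g x : ℂ) := by simp [ft]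
  rw [h, integral_complex_ofReal, hg.integral_eq_one, Complex.ofReal_one]

theorem norm_ft_le {g : ℝ → ℝ} (hg : IsDensity g) (t : ℝ) : ‖ft g t‖ ≤ 1 := by
  refine (norm_integral_le_integral_norm _).trans (le_of_eq ?_)
  rw [← hg.integral_eq_one]
  refine integral_congr_ae (Eventually.of_forall fun x => ?_)
  have : ‖Complex.exp (-(Complex.I * t * x))‖ = 1 := by
    rw [Complex.norm_exp]; simp
  simp only [norm_mul, this, one_mul, Complex.norm_real, Real.norm_of_nonneg (hg.nonneg x)]

/-- The function `φ̃_α` (with its argument rescaled by `2π`) is square integrable for every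
penalty `α > 0` and every order `m ≥ 1`, so its inverse Fourier transform exists in `L²`. -/
theorem memLp_filterFT {g : ℝ → ℝ} (hg : IsDensity g) {m : ℕ} (hm : 1 ≤ m) {α : ℝ}
    (hα : 0 < α) : MemLp (fun s : ℝ => filterFT g m α (2 * Real.pi * s)) 2 := by
  have hc := continuous_ft hg
  have hcont : Continuous fun t => ‖ft g t‖ := hc.norm
  obtain ⟨δ, hδ, hball⟩ : ∃ δ > 0, ∀ t : ℝ, |t| < δ → 1 / 2 < ‖ft g t‖ := by
    have h0 : ∀ᶠ t in 𝓝 (0 : ℝ), 1 / 2 < ‖ft g t‖ := by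
      apply hcont.continuousAt.eventually
      refine lt_mem_nhds ?_
      simp only [ft_zero hg]
      norm_num
    obtain ⟨δ, hδ, h⟩ := Metric.eventually_nhds_iff.mp h0
    exact ⟨δ, hδ, fun t ht => h (by simpa [Real.dist_eq] using ht)⟩
  set K : ℝ := 2 * (1 + δ ^ 2) + (1 / δ ^ 2 + 1) / (α * δ ^ (2 * (m - 1))) with hK
  have hK0 : 0 ≤ K := by positivity
  have key : ∀ t : ℝ, ‖filterFT g m α t‖ ≤ K * (1 + t ^ 2)⁻¹ := by
    intro t
    have hpos : 0 ≤ α * |t| ^ (2 * m) := by positivity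
    have hnorm : ‖filterFT g m α t‖ = ‖ft g t‖ / (‖ft g t‖ ^ 2 + α * |t| ^ (2 * m)) := by
      rw [filterFT, norm_div, RCLike.norm_conj, Complex.norm_real,
        Real.norm_of_nonneg (by positivity)]
    rw [hnorm, ← div_eq_mul_inv]
    have hle := norm_ft_le hg t
    have hnn := norm_nonneg (ft g t)
    rcases lt_or_ge |t| δ with ht | ht
    · have h1 := hball t ht
      have h2 : ‖ft g t‖ / (‖ft g t‖ ^ 2 + α * |t| ^ (2 * m)) ≤ 2 := by
        rw [div_le_iff₀ (by positivity)]
        nlinarith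
      have h3 : t ^ 2 ≤ δ ^ 2 := by
        rw [← sq_abs t]; gcongr
      have h4 : 0 ≤ (1 / δ ^ 2 + 1) / (α * δ ^ (2 * (m - 1))) := by positivity
      refine h2.trans ?_
      rw [le_div_iff₀ (by positivity)]
      nlinarith
    · have htpos : 0 < |t| := hδ.trans_le ht
      have ht2 : δ ^ 2 ≤ t ^ 2 := by
        rw [← sq_abs t]; gcongr
      have hpow : δ ^ (2 * (m - 1)) * t ^ 2 ≤ |t| ^ (2 * m) := by
        have : 2 * m = 2 * (m - 1) + 2 := by omega
        rw [this, pow_add, sq_abs]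
        gcongr
      have hden : α * (δ ^ (2 * (m - 1)) * t ^ 2)
          ≤ ‖ft g t‖ ^ 2 + α * |t| ^ (2 * m) := by
        have := mul_le_mul_of_nonneg_left hpow hα.le
        nlinarith [sq_nonneg ‖ft g t‖]
      have htsq : 0 < t ^ 2 := lt_of_lt_of_le (by positivity) ht2
      have h5 : ‖ft g t‖ / (‖ft g t‖ ^ 2 + α * |t| ^ (2 * m))
          ≤ 1 / (α * (δ ^ (2 * (m - 1)) * t ^ 2)) := by
        gcongr
      refine h5.trans ?_
      have h6 : 1 + t ^ 2 ≤ (1 / δ ^ 2 + 1) * t ^ 2 := by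
        have : 1 ≤ 1 / δ ^ 2 * t ^ 2 := by
          rw [one_div, inv_mul_eq_div, le_div_iff₀ (by positivity)]
          linarith
        linarith
      have h7 : (1 : ℝ) / (α * (δ ^ (2 * (m - 1)) * t ^ 2))
          ≤ ((1 / δ ^ 2 + 1) / (α * δ ^ (2 * (m - 1)))) / (1 + t ^ 2) := by
        rw [div_div, div_le_div_iff₀ (by positivity) (by positivity)]
        have hA : 0 ≤ α * δ ^ (2 * (m - 1)) := by positivity
        nlinarith [mul_le_mul_of_nonneg_left h6 hA]
      refine h7.trans ?_
      gcongr
      rw [hK]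
      have : 0 ≤ 2 * (1 + δ ^ 2) := by positivity
      linarith
  have hmeas : Measurable fun s : ℝ => filterFT g m α (2 * Real.pi * s) := by
    unfold filterFT
    have h1 := hc.measurable
    have h2 : Measurable fun z : ℂ => (starRingEnd ℂ) z := Complex.continuous_conj.measurable
    fun_prop
  rw [memLp_two_iff_integrable_sq_norm hmeas.aestronglyMeasurable]
  refine Integrable.mono' (integrable_inv_one_add_sq.const_mul (K ^ 2))
    (hmeas.norm.pow_const 2).aestronglyMeasurable (Eventually.of_forall fun s => ?_)
  have h8 : (1 + (2 * Real.pi * s) ^ 2)⁻¹ ≤ (1 + s ^ 2)⁻¹ := by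
    refine inv_anti₀ (by positivity) ?_
    have h9 : (1 : ℝ) ≤ (2 * Real.pi) ^ 2 := by nlinarith [Real.pi_gt_three]
    rw [mul_pow]
    nlinarith [sq_nonneg s]
  have h10 : (1 + s ^ 2)⁻¹ ≤ (1 : ℝ) := inv_le_one_of_one_le₀ (by nlinarith [sq_nonneg s])
  have h11 : (0 : ℝ) ≤ (1 + s ^ 2)⁻¹ := by positivity
  rw [Real.norm_of_nonneg (by positivity)]
  calc ‖filterFT g m α (2 * Real.pi * s)‖ ^ 2 ≤ (K * (1 + s ^ 2)⁻¹) ^ 2 := by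
        gcongr
        exact (key _).trans (by gcongr)
    _ = K ^ 2 * ((1 + s ^ 2)⁻¹ * (1 + s ^ 2)⁻¹) := by ring
    _ ≤ K ^ 2 * (1 + s ^ 2)⁻¹ := by
        gcongr
        exact mul_le_of_le_one_right h11 h10

open Classical in
/-- `φ_α(x) = (1/2π) ∫ e^{itx} φ̃_α(t) dt = ∫ e^{2πisx} φ̃_α(2πs) ds`: the inverse Fourier transform
in `L²(ℝ)` (the integral need not converge absolutely). By `memLp_filterFT` the first branch is
the one taken for every density `g`, order `m ≥ 1` and penalty `α > 0`. -/
def filterFn (g : ℝ → ℝ) (m : ℕ) (α : ℝ) : Lp ℂ 2 (volume : Measure ℝ) :=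
  if H : MemLp (fun s : ℝ => filterFT g m α (2 * Real.pi * s)) 2 then 𝓕⁻ (H.toLp _) else 0

/-- The smoothness-penalized deconvolution estimator
`f_N^α(x) = (1/N) ∑ φ_α(x - y_i)` from the sample `y₁, …, y_N`. -/
def estimator (g : ℝ → ℝ) (m : ℕ) (α : ℝ) {N : ℕ} (y : Fin N → ℝ) (x : ℝ) : ℂ :=
  (1 / (N : ℂ)) * ∑ i, filterFn g m α (x - y i)

/-- The integrated squared error `∫ (f_N^α(x) - f(x))² dx`. -/
def loss (f g : ℝ → ℝ) (m : ℕ) (α : ℝ) {N : ℕ} (y : Fin N → ℝ) : ℝ :=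
  ∫ x, ‖estimator g m α y x - (f x : ℂ)‖ ^ 2

/-- The risk `𝓡(α, N) = E ∫ (f_N^α(x) - f(x))² dx` for the sample `Y₁, …, Y_N`. -/
def risk {Ω : Type*} [MeasurableSpace Ω] (μ : Measure Ω) (Y : ℕ → Ω → ℝ)
    (f g : ℝ → ℝ) (m : ℕ) (α : ℝ) (N : ℕ) : ℝ :=
  ∫ ω, loss f g m α (fun i : Fin N => Y i ω) ∂μ

/-- The surrogate risk `R(α, N) = 2π (𝓡(α, N) - ‖f‖²)`. -/
def surrogateRisk {Ω : Type*} [MeasurableSpace Ω] (μ : Measure Ω) (Y : ℕ → Ω → ℝ)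
    (f g : ℝ → ℝ) (m : ℕ) (α : ℝ) (N : ℕ) : ℝ :=
  2 * Real.pi * (risk μ Y f g m α N - ∫ x, f x ^ 2)

/-- The empirical Fourier transform `P̃_n(t) = (1/n) ∑ e^{-it y_j}`. -/
def empiricalFT {n : ℕ} (y : Fin n → ℝ) (t : ℝ) : ℂ :=
  (1 / (n : ℂ)) * ∑ j, Complex.exp (-(Complex.I * t * y j))

/-- `H̃_n(t) = n/(n-1) (|P̃_n(t)|² - 1/n)`, the unbiased estimator of `|h̃(t)|²`. -/
def sqModEstimator {n : ℕ} (y : Fin n → ℝ) (t : ℝ) : ℝ :=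
  (n : ℝ) / ((n : ℝ) - 1) * (‖empiricalFT y t‖ ^ 2 - 1 / (n : ℝ))

/-- The small-n risk criterion `R̂(α, N)` computed from the sample `y₁, …, y_n`:
`(N-1)/N ∫ |φ̃_α|² H̃_n - 2 ∫ (φ̃_α / conj g̃) H̃_n + (1/N) ∫ |φ̃_α|²`.
The quotient `φ̃_α / conj g̃` is `1 / (|g̃|² + α |t|^{2m})` where `g̃ ≠ 0` and `0` where `g̃ = 0`;
it is real, so taking real parts loses nothing. -/
def riskEstimate (g : ℝ → ℝ) (m : ℕ) (α : ℝ) (N : ℕ) {n : ℕ} (y : Fin n → ℝ) : ℝ :=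
  ((N : ℝ) - 1) / (N : ℝ) * (∫ t, ‖filterFT g m α t‖ ^ 2 * sqModEstimator y t)
    - 2 * (∫ t, (filterFT g m α t / conj (ft g t)).re * sqModEstimator y t)
    + 1 / (N : ℝ) * ∫ t, ‖filterFT g m α t‖ ^ 2

end SPeD

end

namespace SPeD

/-! Write `h̃ = f̃ g̃` for the characteristic function of the observations. By Plancherel, `2π`
times the loss is `∫ |P̃_N φ̃_α - f̃|²` (`loss_eq`). Taking expectations with `E|P̃_N|² = (N-1)/N
|h̃|² + 1/N` shows that the surrogate risk is exactly the criterion with `H̃_n` replaced by `|h̃|²`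
(`surrogateRisk_eq`). The error is therefore `∫ w_α (H̃_n - |h̃|²)` with `w_α = (N-1)/N |φ̃_α|² - 2
φ̃_α / conj g̃`.

The decisive point is that `|w_α(t)| ≤ 3C / (b (1 + t²))` with one `C` for all `α ≥ ι b` and `0 < b
≤ M` (`exists_one_add_sq_mul_le`, `filter_weights_le`): near `0` the function `g̃` is close to `1`,
and elsewhere the penalty dominates. Hence a single random quantity free of `α`, the mean of `|P̃_n
- h̃|` under the Cauchy law, controls all penalties at once
(`abs_riskEstimate_sub_surrogateRisk_le`).

Hoeffding's lemma bounds `E exp(√n |P̃_n(t) - h̃(t)|)` uniformly in `t`; Jensen's inequality carries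
this to the Cauchy mean, and summing against `n⁻²` gives almost surely an eventual bound `2 log n /
√n`. The rate hypothesis makes `1 / (√n r b)` of order `n^(-q/2)`, which beats the logarithm. -/

/-! ### Fourier integrals and the Fourier transform on `L²`. -/

theorem continuous_fourier_of_integrable {φ : ℝ → ℂ} (h : Integrable φ) : Continuous (𝓕 φ) :=
  VectorFourier.fourierIntegral_continuous Real.continuous_fourierChar
    (by fun_prop) h

theorem integral_smul_fourier_eq (ψ : ℝ → ℂ) {φ : ℝ → ℂ} (hψ : Integrable ψ) (h : Integrable φ) :
    ∫ x, 𝓕 ψ x • φ x = ∫ x, ψ x • 𝓕 φ x := by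
  have := VectorFourier.integral_fourierIntegral_smul_eq_flip (μ := (volume : Measure ℝ))
    (ν := (volume : Measure ℝ)) (L := innerₗ ℝ) Real.continuous_fourierChar (by fun_prop) hψ h
  rw [flip_innerₗ] at this
  exact this

/-- The `L²` Fourier transform of an integrable function is given by the Fourier integral. -/
theorem fourier_toLp_ae_eq {φ : ℝ → ℂ} (h1 : Integrable φ) (h2 : MemLp φ 2) :
    (𝓕 (h2.toLp φ) : Lp ℂ 2 (volume : Measure ℝ)) =ᵐ[volume] 𝓕 φ := by
  -- It suffices to pair both sides with smooth compactly supported `u`, viewed as Schwartz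
  -- functions. The `L²` transform is then moved onto `u` by duality of tempered distributions, the
  -- Fourier integral by `integral_smul_fourier_eq`.
  refine ae_eq_of_integral_contDiff_smul_eq ((Lp.memLp _).locallyIntegrable (by norm_num))
    (continuous_fourier_of_integrable h1).locallyIntegrable fun u hu hc => ?_
  have hc' : HasCompactSupport (Complex.ofRealCLM ∘ u) := hc.comp_left rfl
  have hu' : ContDiff ℝ (⊤ : ℕ∞) (Complex.ofRealCLM ∘ u) := by fun_prop
  set ψ : SchwartzMap ℝ ℂ := hc'.toSchwartzMap hu' with hψ
  have hψu : ∀ x, ψ x = (u x : ℂ) := fun x => rfl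
  have key := congrArg (fun T => T ψ) (Lp.fourier_toTemperedDistribution_eq (h2.toLp φ))
  simp only [TemperedDistribution.fourier_apply, Lp.toTemperedDistribution_apply] at key
  have e1 : ∫ x, (𝓕 ψ) x • (h2.toLp φ) x = ∫ x, 𝓕 (ψ : ℝ → ℂ) x • φ x := by
    refine integral_congr_ae ?_
    filter_upwards [h2.coeFn_toLp] with x hx
    rw [hx, SchwartzMap.fourier_coe]
  rw [e1, integral_smul_fourier_eq _ ψ.integrable h1] at key
  simpa [hψu] using key.symm

theorem fourierInv_toLp_ae_eq {φ : ℝ → ℂ} (h1 : Integrable φ) (h2 : MemLp φ 2) :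
    (𝓕⁻ (h2.toLp φ) : Lp ℂ 2 (volume : Measure ℝ)) =ᵐ[volume] 𝓕⁻ φ := by
  have hcont : Continuous (𝓕⁻ φ) := by
    have : 𝓕⁻ φ = fun x => 𝓕 φ (-x) := by
      ext x; exact Real.fourierInv_eq_fourier_neg φ x
    rw [this]
    exact (continuous_fourier_of_integrable h1).comp continuous_neg
  refine ae_eq_of_integral_contDiff_smul_eq ((Lp.memLp _).locallyIntegrable (by norm_num))
    hcont.locallyIntegrable fun u hu hc => ?_
  have hc' : HasCompactSupport (Complex.ofRealCLM ∘ u) := hc.comp_left rfl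
  have hu' : ContDiff ℝ (⊤ : ℕ∞) (Complex.ofRealCLM ∘ u) := by fun_prop
  set ψ : SchwartzMap ℝ ℂ := hc'.toSchwartzMap hu' with hψ
  have hψu : ∀ x, ψ x = (u x : ℂ) := fun x => rfl
  have key := congrArg (fun T => T ψ) (Lp.fourierInv_toTemperedDistribution_eq (h2.toLp φ))
  simp only [TemperedDistribution.fourierInv_apply, Lp.toTemperedDistribution_apply] at key
  have e1 : ∫ x, (𝓕⁻ ψ) x • (h2.toLp φ) x = ∫ x, 𝓕 (ψ : ℝ → ℂ) x • φ (-x) := by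
    -- Reflection turns the inverse transform of the test function into the forward one, so that the
    -- same duality identity applies.
    rw [← integral_neg_eq_self]
    refine integral_congr_ae ?_
    have := (Measure.measurePreserving_neg (volume : Measure ℝ)).quasiMeasurePreserving.ae_eq_comp
      h2.coeFn_toLp
    filter_upwards [this] with x hx
    simp only [Function.comp] at hx
    rw [hx, SchwartzMap.fourierInv_coe, Real.fourierInv_eq_fourier_neg, neg_neg]
  have e2 : 𝓕 (fun x => φ (-x)) = 𝓕⁻ φ := by
    ext x; exact (Real.fourierInv_eq_fourier_comp_neg φ ▸ rfl)
  rw [e1, integral_smul_fourier_eq _ ψ.integrable h1.comp_neg, e2] at key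
  simpa [hψu] using key.symm

/-! ### Characteristic functions of densities and of their convolution. -/

variable {f g u : ℝ → ℝ}

theorem IsDensity.integrable (hu : IsDensity u) : Integrable u := by
  by_contra h
  have h1 := hu.integral_eq_one
  rw [integral_undef h] at h1
  exact zero_ne_one h1

theorem ft_eq_fourier (u : ℝ → ℝ) (t : ℝ) :
    ft u t = 𝓕 (fun x => (u x : ℂ)) (t / (2 * Real.pi)) := by
  rw [ft, Real.fourier_real_eq_integral_exp_smul]
  refine integral_congr_ae (Eventually.of_forall fun x => ?_)
  simp only [smul_eq_mul]
  congr 2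
  push_cast
  have : (Real.pi : ℂ) ≠ 0 := by exact_mod_cast Real.pi_ne_zero
  field_simp

theorem fourier_eq_ft (u : ℝ → ℝ) (s : ℝ) :
    𝓕 (fun x => (u x : ℂ)) s = ft u (2 * Real.pi * s) := by
  rw [ft_eq_fourier]
  field_simp

theorem obsDensity_nonneg (hf : IsDensity f) (hg : IsDensity g) (y : ℝ) :
    0 ≤ obsDensity f g y :=
  integral_nonneg fun _ => mul_nonneg (hf.nonneg _) (hg.nonneg _)

theorem aemeasurable_obsDensity (hf : IsDensity f) (hg : IsDensity g) :
    AEMeasurable (obsDensity f g) :=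
  (hf.integrable.integrable_convolution (ContinuousLinearMap.mul ℝ ℝ)
    hg.integrable).aestronglyMeasurable.aemeasurable

theorem ft_obsDensity (hf : IsDensity f) (hg : IsDensity g) (t : ℝ) :
    ft (obsDensity f g) t = ft f t * ft g t := by
  have key := Real.fourier_mul_convolution_eq (f₁ := fun x => (f x : ℂ))
    (f₂ := fun x => (g x : ℂ)) hf.integrable.ofReal hg.integrable.ofReal (t / (2 * Real.pi))
  rw [ft_eq_fourier, ft_eq_fourier, ft_eq_fourier, ← key]
  refine congrArg (fun F : ℝ → ℂ => 𝓕 F (t / (2 * Real.pi))) (funext fun y => ?_)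
  simp only [obsDensity, convolution, ContinuousLinearMap.mul_apply']
  rw [← integral_complex_ofReal]
  simp

/-- The characteristic function of a random variable whose density is a convolution. -/
theorem integral_exp_of_map_eq {Ω : Type*} [MeasurableSpace Ω] {μ : Measure Ω}
    (hf : IsDensity f) (hg : IsDensity g) {X : Ω → ℝ} (hX : Measurable X)
    (hlaw : μ.map X = volume.withDensity fun y => ENNReal.ofReal (obsDensity f g y)) (t : ℝ) :
    ∫ ω, Complex.exp (-(Complex.I * t * X ω)) ∂μ = ft f t * ft g t := by
  rw [← integral_map (f := fun x : ℝ => Complex.exp (-(Complex.I * t * x))) hX.aemeasurable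
    (Continuous.aestronglyMeasurable (by fun_prop)), hlaw,
    integral_withDensity_eq_integral_toReal_smul₀
      (aemeasurable_obsDensity hf hg).ennreal_ofReal (by simp), ← ft_obsDensity hf hg, ft]
  refine integral_congr_ae (Eventually.of_forall fun x => ?_)
  simp only [ENNReal.toReal_ofReal (obsDensity_nonneg hf hg x), Complex.real_smul]
  ring

theorem norm_exp_neg_I_mul (t x : ℝ) : ‖Complex.exp (-(Complex.I * t * x))‖ = 1 := by
  rw [Complex.norm_exp]; simp

/-! ### Bounds on the filter weights, uniform in the penalty. -/

/-- The denominator of the filter, uniformly bounded below for penalties that are not too small. -/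
theorem exists_one_add_sq_mul_le (hg : IsDensity g) {m : ℕ} (hm : 1 ≤ m) {ι : ℝ} (hι : 0 < ι)
    (M : ℝ) : ∃ C > 0, ∀ b α t : ℝ, 0 < b → b ≤ M → ι * b ≤ α →
      (1 + t ^ 2) * b ≤ C * (‖ft g t‖ ^ 2 + α * |t| ^ (2 * m)) := by
  have hcont : Continuous fun t => ‖ft g t‖ := (continuous_ft hg).norm
  obtain ⟨δ, hδ, hball⟩ : ∃ δ > 0, ∀ t : ℝ, |t| < δ → 1 / 2 < ‖ft g t‖ := by
    have h0 : ∀ᶠ t in 𝓝 (0 : ℝ), 1 / 2 < ‖ft g t‖ := by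
      apply hcont.continuousAt.eventually
      refine lt_mem_nhds ?_
      simp only [ft_zero hg]
      norm_num
    obtain ⟨δ, hδ, h⟩ := Metric.eventually_nhds_iff.mp h0
    exact ⟨δ, hδ, fun t ht => h (by simpa [Real.dist_eq] using ht)⟩
  -- The first summand serves `|t| < δ`, where `|g̃| > 1/2` makes the denominator at least `1/4`.
  -- The second serves `|t| ≥ δ`, where `|t|^(2m) ≥ δ^(2(m-1)) t²` and `α ≥ ι b`.
  refine ⟨4 * (1 + δ ^ 2) * |M| + (1 / δ ^ 2 + 1) / (ι * δ ^ (2 * (m - 1))), by positivity, ?_⟩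
  intro b α t hb hbM hα
  have hαpos : 0 < α := lt_of_lt_of_le (by positivity) hα
  have hpos : 0 ≤ α * |t| ^ (2 * m) := by positivity
  have hA : 0 ≤ 4 * (1 + δ ^ 2) * |M| := by positivity
  have hB : 0 ≤ (1 / δ ^ 2 + 1) / (ι * δ ^ (2 * (m - 1))) := by positivity
  rcases lt_or_ge |t| δ with ht | ht
  · have h1 : 1 / 4 ≤ ‖ft g t‖ ^ 2 + α * |t| ^ (2 * m) := by nlinarith [hball t ht]
    have h3 : t ^ 2 ≤ δ ^ 2 := by
      rw [← sq_abs t]; gcongr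
    calc (1 + t ^ 2) * b ≤ (1 + δ ^ 2) * |M| := by
          gcongr
          exact hbM.trans (le_abs_self M)
      _ = (4 * (1 + δ ^ 2) * |M|) * (1 / 4) := by ring
      _ ≤ _ := by gcongr; linarith
  · have ht2 : δ ^ 2 ≤ t ^ 2 := by
      rw [← sq_abs t]; gcongr
    have hpow : δ ^ (2 * (m - 1)) * t ^ 2 ≤ |t| ^ (2 * m) := by
      have : 2 * m = 2 * (m - 1) + 2 := by omega
      rw [this, pow_add, sq_abs]
      gcongr
    have h6 : 1 + t ^ 2 ≤ (1 / δ ^ 2 + 1) * t ^ 2 := by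
      have : 1 ≤ 1 / δ ^ 2 * t ^ 2 := by
        rw [one_div, inv_mul_eq_div, le_div_iff₀ (by positivity)]
        linarith
      linarith
    calc (1 + t ^ 2) * b ≤ (1 / δ ^ 2 + 1) * t ^ 2 * b := by gcongr
      _ = (1 / δ ^ 2 + 1) / (ι * δ ^ (2 * (m - 1))) * (ι * b * (δ ^ (2 * (m - 1)) * t ^ 2)) := by
          field_simp
      _ ≤ (1 / δ ^ 2 + 1) / (ι * δ ^ (2 * (m - 1))) * (‖ft g t‖ ^ 2 + α * |t| ^ (2 * m)) := by
          gcongr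
          calc ι * b * (δ ^ (2 * (m - 1)) * t ^ 2) ≤ α * |t| ^ (2 * m) := by gcongr
            _ ≤ _ := by nlinarith [sq_nonneg ‖ft g t‖]
      _ ≤ _ := by
          gcongr
          linarith

theorem norm_filterFT (g : ℝ → ℝ) (m : ℕ) {α : ℝ} (hα : 0 ≤ α) (t : ℝ) :
    ‖filterFT g m α t‖ = ‖ft g t‖ / (‖ft g t‖ ^ 2 + α * |t| ^ (2 * m)) := by
  rw [filterFT, norm_div, RCLike.norm_conj, Complex.norm_real,
    Real.norm_of_nonneg (by positivity)]

/-- Away from the zeros of `g̃` the factor `conj g̃` cancels and a real number remains; at the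
zeros, `x / 0 = 0` agrees with the convention for the quotient. -/
theorem filterFT_div_conj (g : ℝ → ℝ) (m : ℕ) (α t : ℝ) :
    filterFT g m α t / conj (ft g t) =
      ((if ft g t = 0 then 0 else (‖ft g t‖ ^ 2 + α * |t| ^ (2 * m))⁻¹ : ℝ) : ℂ) := by
  split_ifs with h
  · simp [h]
  · have : conj (ft g t) ≠ 0 := by simpa using h
    rw [filterFT, div_right_comm, div_self this, Complex.ofReal_inv, one_div]

/-- The common bound of the three weights that occur in the risk criterion. -/
theorem filter_weights_le (hg : IsDensity g) (m : ℕ) {α b C t : ℝ} (hα : 0 < α) (hb : 0 < b)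
    (hC : 0 < C)
    (h : (1 + t ^ 2) * b ≤ C * (‖ft g t‖ ^ 2 + α * |t| ^ (2 * m))) :
    ‖filterFT g m α t‖ ≤ C / b * (1 + t ^ 2)⁻¹ ∧
    ‖filterFT g m α t‖ ^ 2 ≤ C / b * (1 + t ^ 2)⁻¹ ∧
    |(filterFT g m α t / conj (ft g t)).re| ≤ C / b * (1 + t ^ 2)⁻¹ := by
  set D := ‖ft g t‖ ^ 2 + α * |t| ^ (2 * m) with hD
  have hDpos : 0 < D := by
    have : 0 < C * D := lt_of_lt_of_le (by positivity) h
    exact pos_of_mul_pos_right this hC.le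
  -- All three weights are at most `D⁻¹`: the first because `|g̃| ≤ 1`, the second because `|g̃|² ≤
  -- D`, the third by its explicit form.
  have hinv : D⁻¹ ≤ C / b * (1 + t ^ 2)⁻¹ := by
    rw [inv_eq_one_div, div_mul_eq_mul_div, ← div_eq_mul_inv, div_div,
      div_le_div_iff₀ hDpos (by positivity)]
    linarith
  have h1 := norm_ft_le hg t
  have h0 := norm_nonneg (ft g t)
  have hD2 : ‖ft g t‖ ^ 2 ≤ D := by
    have : 0 ≤ α * |t| ^ (2 * m) := by positivity
    linarith
  refine ⟨?_, ?_, ?_⟩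
  · rw [norm_filterFT g m hα.le]
    refine le_trans ?_ hinv
    rw [inv_eq_one_div]
    gcongr
  · rw [norm_filterFT g m hα.le]
    refine le_trans ?_ hinv
    rw [← hD, div_pow, inv_eq_one_div, div_le_div_iff₀ (by positivity) hDpos]
    nlinarith
  · rw [filterFT_div_conj, Complex.ofReal_re]
    split_ifs
    · rw [abs_zero]; positivity
    · rwa [abs_of_pos (inv_pos.mpr hDpos)]

theorem measurable_filterFT (hg : IsDensity g) (m : ℕ) (α : ℝ) : Measurable (filterFT g m α) := by
  unfold filterFT
  have h1 := (continuous_ft hg).measurable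
  have h2 : Measurable fun z : ℂ => (starRingEnd ℂ) z := Complex.continuous_conj.measurable
  fun_prop

theorem measurable_re_filterFT_div (hg : IsDensity g) (m : ℕ) (α : ℝ) :
    Measurable fun t => (filterFT g m α t / conj (ft g t)).re := by
  have h1 := (continuous_ft hg).measurable
  have h2 : Measurable fun z : ℂ => (starRingEnd ℂ) z := Complex.continuous_conj.measurable
  have h3 := measurable_filterFT hg m α
  fun_prop

/-- For a fixed penalty the weights are dominated by a multiple of `(1 + t²)⁻¹`. -/
theorem exists_filter_weights_le (hg : IsDensity g) {m : ℕ} (hm : 1 ≤ m) {α : ℝ} (hα : 0 < α) :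
    ∃ K > 0, ∀ t, ‖filterFT g m α t‖ ≤ K * (1 + t ^ 2)⁻¹ ∧
      ‖filterFT g m α t‖ ^ 2 ≤ K * (1 + t ^ 2)⁻¹ ∧
      |(filterFT g m α t / conj (ft g t)).re| ≤ K * (1 + t ^ 2)⁻¹ := by
  obtain ⟨C, hC, h⟩ := exists_one_add_sq_mul_le hg hm hα 1
  exact ⟨C / 1, by positivity, fun t =>
    filter_weights_le hg m hα one_pos hC (h 1 α t one_pos le_rfl (by simp))⟩

/-! ### Plancherel's identity and the integrated squared error. -/

theorem integral_norm_sq_eq_norm_Lp_sq (u : Lp ℂ 2 (volume : Measure ℝ)) :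
    ∫ x, ‖u x‖ ^ 2 = ‖u‖ ^ 2 := by
  have h : ((∫ x, ‖u x‖ ^ 2 : ℝ) : ℂ) = ((‖u‖ ^ 2 : ℝ) : ℂ) := by
    rw [← integral_complex_ofReal]
    push_cast
    have := inner_self_eq_norm_sq_to_K (𝕜 := ℂ) u
    rw [L2.inner_def] at this
    simpa [inner_self_eq_norm_sq_to_K] using this
  exact_mod_cast h

/-- Plancherel's identity for the distance of an inverse Fourier integral to an `L²` function. -/
theorem integral_norm_fourierInv_sub_sq {φ v : ℝ → ℂ} (hφ1 : Integrable φ) (hφ2 : MemLp φ 2)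
    (hv1 : Integrable v) (hv2 : MemLp v 2) :
    ∫ x, ‖𝓕⁻ φ x - v x‖ ^ 2 = ∫ s, ‖φ s - 𝓕 v s‖ ^ 2 := by
  set Φ : Lp ℂ 2 (volume : Measure ℝ) := hφ2.toLp φ
  set V : Lp ℂ 2 (volume : Measure ℝ) := hv2.toLp v
  have h1 : ∫ x, ‖𝓕⁻ φ x - v x‖ ^ 2 = ‖𝓕⁻ Φ - V‖ ^ 2 := by
    rw [← integral_norm_sq_eq_norm_Lp_sq]
    refine integral_congr_ae ?_
    filter_upwards [fourierInv_toLp_ae_eq hφ1 hφ2, hv2.coeFn_toLp,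
      Lp.coeFn_sub (𝓕⁻ Φ) V] with x h1 h2 h3
    rw [h3, Pi.sub_apply, h1, h2]
  have h2 : ∫ s, ‖φ s - 𝓕 v s‖ ^ 2 = ‖Φ - 𝓕 V‖ ^ 2 := by
    rw [← integral_norm_sq_eq_norm_Lp_sq]
    refine integral_congr_ae ?_
    filter_upwards [fourier_toLp_ae_eq hv1 hv2, hφ2.coeFn_toLp,
      Lp.coeFn_sub Φ (𝓕 V)] with x h1 h2 h3
    rw [h3, Pi.sub_apply, h1, h2]
  have h3 : 𝓕 (𝓕⁻ Φ - V) = Φ - 𝓕 V := by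
    have hsub : 𝓕 (𝓕⁻ Φ - V) = 𝓕 (𝓕⁻ Φ) - 𝓕 V :=
      (Lp.fourierTransformₗᵢ ℝ ℂ).map_sub _ _
    rw [hsub, FourierTransform.fourier_fourierInv_eq]
  rw [h1, h2, ← h3, Lp.norm_fourier_eq]

theorem continuous_empiricalFT {n : ℕ} (y : Fin n → ℝ) : Continuous (empiricalFT y) := by
  unfold empiricalFT
  fun_prop

theorem norm_empiricalFT_le {n : ℕ} (y : Fin n → ℝ) (t : ℝ) : ‖empiricalFT y t‖ ≤ 1 := by
  rw [empiricalFT, norm_mul]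
  calc ‖(1 / (n : ℂ))‖ * ‖∑ j, Complex.exp (-(Complex.I * t * y j))‖
      ≤ (1 / n) * ∑ j : Fin n, (1 : ℝ) := by
        gcongr
        · simp
        · exact (norm_sum_le _ _).trans (Finset.sum_le_sum fun j _ => (norm_exp_neg_I_mul _ _).le)
    _ ≤ 1 := by
        rw [Finset.sum_const, Finset.card_univ, Fintype.card_fin, nsmul_eq_mul, mul_one,
          one_div_mul_eq_div]
        exact div_self_le_one _

/-- The decay `(1 + t²)⁻¹` makes the filter integrable as well as square integrable, so `φ_α` is
almost everywhere an ordinary Fourier integral whose translates can be computed pointwise. -/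
theorem integrable_rescaled_filterFT (hg : IsDensity g) {m : ℕ} (hm : 1 ≤ m) {α : ℝ}
    (hα : 0 < α) : Integrable fun s : ℝ => filterFT g m α (2 * Real.pi * s) := by
  obtain ⟨K, hK, h⟩ := exists_filter_weights_le hg hm hα
  have : Integrable (filterFT g m α) :=
    Integrable.mono' (integrable_inv_one_add_sq.const_mul K)
      (measurable_filterFT hg m α).aestronglyMeasurable (Eventually.of_forall fun t => (h t).1)
  exact this.comp_mul_left' (by positivity)

/-- Translation by `y i` is multiplication by a character on the Fourier side. -/
theorem fourierInv_empirical_mul {φ : ℝ → ℂ} (hφ : Integrable φ) {n : ℕ} (y : Fin n → ℝ) (x : ℝ) :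
    𝓕⁻ (fun s => empiricalFT y (2 * Real.pi * s) * φ s) x =
      (1 / (n : ℂ)) * ∑ i, 𝓕⁻ φ (x - y i) := by
  simp only [Real.fourierInv_eq']
  rw [← integral_finsetSum, ← integral_const_mul]
  · refine integral_congr_ae (Eventually.of_forall fun s => ?_)
    simp only [empiricalFT, smul_eq_mul, Finset.mul_sum, Finset.sum_mul]
    refine Finset.sum_congr rfl fun j _ => ?_
    have : Complex.exp (((2 * Real.pi * inner ℝ s (x - y j) : ℝ) : ℂ) * Complex.I) =
        Complex.exp (-(Complex.I * (2 * Real.pi * s : ℝ) * y j)) *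
        Complex.exp (((2 * Real.pi * inner ℝ s x : ℝ) : ℂ) * Complex.I) := by
      rw [← Complex.exp_add]
      congr 1
      simp
      ring
    rw [this]
    ring
  · intro i _
    have hc : Continuous fun s : ℝ =>
        Complex.exp (((2 * Real.pi * inner ℝ s (x - y i) : ℝ) : ℂ) * Complex.I) := by fun_prop
    refine hφ.mono (hc.aestronglyMeasurable.smul hφ.1)
      (Eventually.of_forall fun s => ?_)
    rw [norm_smul, Complex.norm_exp_ofReal_mul_I, one_mul]

theorem loss_eq (hf : IsDensity f) (hf2 : MemLp f 2) (hg : IsDensity g) {m : ℕ} (hm : 1 ≤ m)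
    {α : ℝ} (hα : 0 < α) {n : ℕ} (y : Fin n → ℝ) :
    2 * Real.pi * loss f g m α y = ∫ t, ‖empiricalFT y t * filterFT g m α t - ft f t‖ ^ 2 := by
  set φ : ℝ → ℂ := fun s => filterFT g m α (2 * Real.pi * s) with hφ
  have hφ1 : Integrable φ := integrable_rescaled_filterFT hg hm hα
  have hφ2 : MemLp φ 2 := memLp_filterFT hg hm hα
  set ψ : ℝ → ℂ := fun s => empiricalFT y (2 * Real.pi * s) * φ s with hψ
  have hm' : AEStronglyMeasurable ψ :=
    (((continuous_empiricalFT y).comp (by fun_prop :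
      Continuous fun s : ℝ => 2 * Real.pi * s)).aestronglyMeasurable).mul hφ1.1
  have hle : ∀ s, ‖ψ s‖ ≤ ‖φ s‖ := fun s => by
    rw [hψ, norm_mul]
    exact mul_le_of_le_one_left (norm_nonneg _) (norm_empiricalFT_le _ _)
  have hψ1 : Integrable ψ := hφ1.mono hm' (Eventually.of_forall hle)
  have hψ2 : MemLp ψ 2 := hφ2.mono hm' (Eventually.of_forall hle)
  have hest : (fun x => estimator g m α y x) =ᵐ[volume] 𝓕⁻ ψ := by
    have hfn : filterFn g m α =ᵐ[volume] 𝓕⁻ φ := by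
      rw [filterFn, dif_pos hφ2]
      exact fourierInv_toLp_ae_eq hφ1 hφ2
    -- `filterFn` is only an `L²` class, but translations preserve null sets and finitely many of
    -- them occur.
    have hall : ∀ᵐ x : ℝ, ∀ i, filterFn g m α (x - y i) = 𝓕⁻ φ (x - y i) := by
      rw [ae_all_iff]
      intro i
      exact (measurePreserving_sub_right volume (y i)).quasiMeasurePreserving.ae_eq_comp hfn
    filter_upwards [hall] with x hx
    rw [estimator, hψ, fourierInv_empirical_mul hφ1]
    simp only [hx]
  have hpl : loss f g m α y = ∫ s, ‖ψ s - 𝓕 (fun x => (f x : ℂ)) s‖ ^ 2 := by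
    have hf1' : Integrable fun x => (f x : ℂ) := hf.integrable.ofReal
    have hf2' : MemLp (fun x => (f x : ℂ)) 2 := hf2.ofReal
    rw [← integral_norm_fourierInv_sub_sq hψ1 hψ2 hf1' hf2', loss]
    refine integral_congr_ae ?_
    filter_upwards [hest] with x hx
    rw [hx]
  -- The substitution `t = 2π s` produces the factor `2π`.
  have hcv := Measure.integral_comp_mul_left
    (fun t => ‖empiricalFT y t * filterFT g m α t - ft f t‖ ^ 2) (2 * Real.pi)
  rw [hpl]
  simp only [fourier_eq_ft, hψ, hφ]
  rw [hcv, abs_of_pos (by positivity), smul_eq_mul, ← mul_assoc, mul_inv_cancel₀ (by positivity),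
    one_mul]

theorem integrable_norm_ft_sq (hf : IsDensity f) (hf2 : MemLp f 2) :
    Integrable fun t => ‖ft f t‖ ^ 2 := by
  have hf2' : MemLp (fun x => (f x : ℂ)) 2 := hf2.ofReal
  have hf1' : Integrable fun x => (f x : ℂ) := hf.integrable.ofReal
  have h := (memLp_congr_ae (fourier_toLp_ae_eq hf1' hf2')).mp (Lp.memLp _)
  rw [memLp_two_iff_integrable_sq_norm h.1] at h
  simp only [fourier_eq_ft] at h
  rwa [integrable_comp_mul_left_iff (fun t => ‖ft f t‖ ^ 2) (by positivity)] at h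

/-- Plancherel, as the case `φ = 0` of `integral_norm_fourierInv_sub_sq`. -/
theorem integral_norm_ft_sq (hf : IsDensity f) (hf2 : MemLp f 2) :
    ∫ t, ‖ft f t‖ ^ 2 = 2 * Real.pi * ∫ x, f x ^ 2 := by
  have hf2' : MemLp (fun x => (f x : ℂ)) 2 := hf2.ofReal
  have h := integral_norm_fourierInv_sub_sq (φ := 0) (v := fun x => (f x : ℂ))
    (integrable_zero _ _ _) MemLp.zero hf.integrable.ofReal hf2'
  have h0 : ∀ x, 𝓕⁻ (0 : ℝ → ℂ) x = 0 := fun x => by simp [Real.fourierInv_eq']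
  simp only [h0, Pi.zero_apply, zero_sub, norm_neg, Complex.norm_real, Real.norm_eq_abs, sq_abs,
    fourier_eq_ft] at h
  rw [h, Measure.integral_comp_mul_left (fun t => ‖ft f t‖ ^ 2), abs_of_pos (by positivity),
    smul_eq_mul, ← mul_assoc, mul_inv_cancel₀ (by positivity), one_mul]

/-! ### Moments of the empirical characteristic function. -/

section Sample

variable {Ω : Type*} [MeasurableSpace Ω] {μ : Measure Ω} [IsProbabilityMeasure μ] {Y : ℕ → Ω → ℝ}

theorem continuous_exp_neg_I_mul (t : ℝ) :
    Continuous fun x : ℝ => Complex.exp (-(Complex.I * t * x)) := by fun_prop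

theorem integrable_exp_neg_I_mul {X : Ω → ℝ} (hX : Measurable X) (t : ℝ) :
    Integrable (fun ω => Complex.exp (-(Complex.I * t * X ω))) μ :=
  Integrable.of_bound ((continuous_exp_neg_I_mul t).measurable.comp hX).aestronglyMeasurable 1
    (Eventually.of_forall fun _ => (norm_exp_neg_I_mul _ _).le)

theorem measurable_uncurry_empiricalFT (hY : ∀ j, Measurable (Y j)) (n : ℕ) :
    Measurable fun z : Ω × ℝ => empiricalFT (fun j : Fin n => Y j z.1) z.2 := by
  unfold empiricalFT
  fun_prop

theorem measurable_empiricalFT (hY : ∀ j, Measurable (Y j)) (n : ℕ) (t : ℝ) :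
    Measurable fun ω => empiricalFT (fun j : Fin n => Y j ω) t := by
  unfold empiricalFT
  fun_prop

theorem integrable_empiricalFT (hY : ∀ j, Measurable (Y j)) (n : ℕ) (t : ℝ) :
    Integrable (fun ω => empiricalFT (fun j : Fin n => Y j ω) t) μ :=
  Integrable.of_bound (measurable_empiricalFT hY n t).aestronglyMeasurable 1
    (Eventually.of_forall fun _ => norm_empiricalFT_le _ _)

theorem integral_empiricalFT (hY : ∀ j, Measurable (Y j)) {n : ℕ} (hn : n ≠ 0) {t : ℝ} {c : ℂ}
    (hc : ∀ j, ∫ ω, Complex.exp (-(Complex.I * t * Y j ω)) ∂μ = c) :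
    ∫ ω, empiricalFT (fun j : Fin n => Y j ω) t ∂μ = c := by
  simp only [empiricalFT]
  rw [integral_const_mul, integral_finsetSum _ fun (j : Fin n) _ => integrable_exp_neg_I_mul (hY j) t]
  simp only [hc, Finset.sum_const, Finset.card_univ, Fintype.card_fin, nsmul_eq_mul]
  have : (n : ℂ) ≠ 0 := by exact_mod_cast hn
  field_simp

/-- In the double sum for `|P̃_n|²` the `n` diagonal terms equal `1`, and by independence the
`n(n-1)` others have mean `|c|²`. -/
theorem integral_norm_empiricalFT_sq (hY : ∀ j, Measurable (Y j)) (hindep : iIndepFun Y μ)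
    {n : ℕ} (hn : n ≠ 0) {t : ℝ} {c : ℂ}
    (hc : ∀ j, ∫ ω, Complex.exp (-(Complex.I * t * Y j ω)) ∂μ = c) :
    ∫ ω, ‖empiricalFT (fun j : Fin n => Y j ω) t‖ ^ 2 ∂μ =
      ((n : ℝ) - 1) / n * ‖c‖ ^ 2 + 1 / n := by
  set e : ℕ → Ω → ℂ := fun j ω => Complex.exp (-(Complex.I * t * Y j ω)) with he
  have hem : ∀ j, AEStronglyMeasurable (e j) μ := fun j => (integrable_exp_neg_I_mul (hY j) t).1
  have hem' : ∀ j, AEStronglyMeasurable (fun ω => conj (e j ω)) μ := fun j =>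
    Complex.continuous_conj.comp_aestronglyMeasurable (hem j)
  have hnorm : ∀ j ω, ‖e j ω‖ = 1 := fun j ω => norm_exp_neg_I_mul _ _
  have hint : ∀ i j, Integrable (fun ω => e i ω * conj (e j ω)) μ := fun i j =>
    Integrable.of_bound ((hem i).mul (hem' j)) 1 (Eventually.of_forall fun ω => by
      rw [norm_mul, RCLike.norm_conj, hnorm, hnorm, one_mul])
  have hpair : ∀ i j, ∫ ω, e i ω * conj (e j ω) ∂μ = if i = j then 1 else c * conj c := by
    intro i j
    split_ifs with hij
    · subst hij
      simp [Complex.mul_conj', hnorm]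
    · have hind : IndepFun (e i) (fun ω => conj (e j ω)) μ :=
        (hindep.indepFun hij).comp (φ := fun x : ℝ => Complex.exp (-(Complex.I * t * x)))
          (ψ := fun x : ℝ => conj (Complex.exp (-(Complex.I * t * x))))
          (continuous_exp_neg_I_mul t).measurable
          (Complex.continuous_conj.comp (continuous_exp_neg_I_mul t)).measurable
      rw [hind.integral_fun_mul_eq_mul_integral (hem i) (hem' j), integral_conj, hc, hc]
  have hn' : (n : ℂ) ≠ 0 := by exact_mod_cast hn
  have hC : ((∫ ω, ‖empiricalFT (fun j : Fin n => Y j ω) t‖ ^ 2 ∂μ : ℝ) : ℂ) =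
      ((((n : ℝ) - 1) / n * ‖c‖ ^ 2 + 1 / n : ℝ) : ℂ) := by
    rw [← integral_complex_ofReal]
    have hexp : ∀ ω, ((‖empiricalFT (fun j : Fin n => Y j ω) t‖ ^ 2 : ℝ) : ℂ) =
        (1 / (n : ℂ) ^ 2) * ∑ i : Fin n, ∑ j : Fin n, e i ω * conj (e j ω) := by
      intro ω
      push_cast
      rw [← Complex.mul_conj', empiricalFT, map_mul, map_sum, mul_mul_mul_comm,
        Finset.sum_mul_sum]
      simp [he, sq]
    simp only [hexp]
    rw [integral_const_mul, integral_finsetSum _ fun (i : Fin n) _ =>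
      integrable_finsetSum _ fun (j : Fin n) _ => hint i j]
    have hrow : ∀ i : Fin n, ∫ ω, ∑ j : Fin n, e i ω * conj (e j ω) ∂μ =
        1 + ((n : ℂ) - 1) * (c * conj c) := by
      intro i
      rw [integral_finsetSum _ fun (j : Fin n) _ => hint i j]
      simp only [hpair, Fin.val_inj]
      rw [← Finset.add_sum_erase _ _ (Finset.mem_univ i), if_pos rfl,
        Finset.sum_congr rfl fun j hj => if_neg (Finset.ne_of_mem_erase hj).symm,
        Finset.sum_const, Finset.card_erase_of_mem (Finset.mem_univ i), Finset.card_univ,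
        Fintype.card_fin, nsmul_eq_mul, Nat.cast_pred (Nat.pos_of_ne_zero hn)]
    simp only [hrow, Finset.sum_const, Finset.card_univ, Fintype.card_fin, nsmul_eq_mul]
    rw [Complex.mul_conj']
    push_cast
    field_simp
    ring
  exact_mod_cast hC

theorem integral_norm_empiricalFT_mul_sub_sq (hY : ∀ j, Measurable (Y j)) (hindep : iIndepFun Y μ)
    {n : ℕ} (hn : n ≠ 0) {t : ℝ} {c : ℂ}
    (hc : ∀ j, ∫ ω, Complex.exp (-(Complex.I * t * Y j ω)) ∂μ = c) (a b : ℂ) :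
    ∫ ω, ‖empiricalFT (fun j : Fin n => Y j ω) t * a - b‖ ^ 2 ∂μ =
      (((n : ℝ) - 1) / n * ‖c‖ ^ 2 + 1 / n) * ‖a‖ ^ 2 - 2 * (c * a * conj b).re + ‖b‖ ^ 2 := by
  have hexp : ∀ ω, ‖empiricalFT (fun j : Fin n => Y j ω) t * a - b‖ ^ 2 =
      ‖empiricalFT (fun j : Fin n => Y j ω) t‖ ^ 2 * ‖a‖ ^ 2 -
        2 * (empiricalFT (fun j : Fin n => Y j ω) t * (a * conj b)).re + ‖b‖ ^ 2 := by
    intro ω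
    rw [← Complex.normSq_eq_norm_sq, Complex.normSq_sub, Complex.normSq_mul,
      Complex.normSq_eq_norm_sq, Complex.normSq_eq_norm_sq, Complex.normSq_eq_norm_sq, mul_assoc]
    ring
  have hi1 : Integrable (fun ω => ‖empiricalFT (fun j : Fin n => Y j ω) t‖ ^ 2 * ‖a‖ ^ 2) μ := by
    refine Integrable.mul_const ?_ _
    refine Integrable.of_bound
      ((measurable_empiricalFT hY n t).norm.pow_const 2).aestronglyMeasurable 1
      (Eventually.of_forall fun ω => ?_)
    rw [Real.norm_of_nonneg (by positivity)]
    exact pow_le_one₀ (norm_nonneg _) (norm_empiricalFT_le _ _)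
  have hi2 : Integrable (fun ω => empiricalFT (fun j : Fin n => Y j ω) t * (a * conj b)) μ :=
    (integrable_empiricalFT hY n t).mul_const _
  have hre : ∫ ω, (empiricalFT (fun j : Fin n => Y j ω) t * (a * conj b)).re ∂μ =
      (c * a * conj b).re := by
    have h1 : ∫ ω, (empiricalFT (fun j : Fin n => Y j ω) t * (a * conj b)).re ∂μ =
        (∫ ω, empiricalFT (fun j : Fin n => Y j ω) t * (a * conj b) ∂μ).re := integral_re hi2
    rw [h1, integral_mul_const, integral_empiricalFT hY hn hc, mul_assoc]
  have hi3 : Integrable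
      (fun ω => 2 * (empiricalFT (fun j : Fin n => Y j ω) t * (a * conj b)).re) μ :=
    hi2.re.const_mul 2
  simp only [hexp]
  rw [integral_add (by exact hi1.sub hi3) (integrable_const _), integral_sub hi1 hi3,
    integral_mul_const, integral_norm_empiricalFT_sq hY hindep hn hc, integral_const_mul, hre]
  simp

end Sample

/-! ### The exact surrogate risk. -/

theorem integrable_mul_of_abs_le_inv_one_add_sq {w v : ℝ → ℝ} (hw : Measurable w) {K : ℝ}
    (hwK : ∀ t, |w t| ≤ K * (1 + t ^ 2)⁻¹) (hv : AEStronglyMeasurable v) {B : ℝ}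
    (hvB : ∀ t, |v t| ≤ B) : Integrable fun t => w t * v t :=
  Integrable.mul_bdd (c := B)
    (Integrable.mono' (integrable_inv_one_add_sq.const_mul K) hw.aestronglyMeasurable
      (Eventually.of_forall hwK)) hv (Eventually.of_forall hvB)

/-- Brings the cross term of the expanded risk into the form it has in the criterion. Where `g̃ = 0`
both sides vanish, so the convention for the quotient does no harm. -/
theorem mul_filterFT_mul_conj_re (f g : ℝ → ℝ) (m : ℕ) (α t : ℝ) :
    (ft f t * ft g t * filterFT g m α t * conj (ft f t)).re =
      (filterFT g m α t / conj (ft g t)).re * ‖ft f t * ft g t‖ ^ 2 := by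
  by_cases h : ft g t = 0
  · simp [h]
  · have h' : conj (ft g t) ≠ 0 := by simpa using h
    have key : ft f t * ft g t * filterFT g m α t * conj (ft f t) =
        ((‖ft f t * ft g t‖ ^ 2 : ℝ) : ℂ) * (filterFT g m α t / conj (ft g t)) := by
      push_cast
      rw [← Complex.mul_conj', map_mul]
      field_simp
    rw [key, Complex.re_ofReal_mul, mul_comm]

theorem norm_ft_mul_ft_le (hf : IsDensity f) (hg : IsDensity g) (t : ℝ) :
    ‖ft f t * ft g t‖ ≤ 1 := by
  rw [norm_mul]
  exact mul_le_one₀ (norm_ft_le hf t) (norm_nonneg _) (norm_ft_le hg t)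

/-- The right side is `riskEstimate` with `H̃_n` replaced by its target `|h̃|²`. It comes from
`loss_eq`, Fubini and the second moments of `P̃_N`; the remaining `∫ |f̃|²` is cancelled by `2π ∫
f²`. -/
theorem surrogateRisk_eq {Ω : Type*} [MeasurableSpace Ω] {μ : Measure Ω} [IsProbabilityMeasure μ]
    (hf : IsDensity f) (hf2 : MemLp f 2) (hg : IsDensity g) {m : ℕ} (hm : 1 ≤ m)
    {Y : ℕ → Ω → ℝ} (hY : ∀ j, Measurable (Y j)) (hindep : iIndepFun Y μ)
    (hlaw : ∀ j, μ.map (Y j) = volume.withDensity fun y => ENNReal.ofReal (obsDensity f g y))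
    {α : ℝ} (hα : 0 < α) {N : ℕ} (hN : N ≠ 0) :
    surrogateRisk μ Y f g m α N =
      ((N : ℝ) - 1) / N * (∫ t, ‖filterFT g m α t‖ ^ 2 * ‖ft f t * ft g t‖ ^ 2)
      - 2 * (∫ t, (filterFT g m α t / conj (ft g t)).re * ‖ft f t * ft g t‖ ^ 2)
      + 1 / (N : ℝ) * ∫ t, ‖filterFT g m α t‖ ^ 2 := by
  obtain ⟨K, hK, hbd⟩ := exists_filter_weights_le hg hm hα
  have hmφ := measurable_filterFT hg m α
  have hcf := continuous_ft hf
  have hcg := continuous_ft hg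
  have hfsq := integrable_norm_ft_sq hf hf2
  have hφsq : Integrable fun t => ‖filterFT g m α t‖ ^ 2 :=
    Integrable.mono' (integrable_inv_one_add_sq.const_mul K)
      (hmφ.norm.pow_const 2).aestronglyMeasurable (Eventually.of_forall fun t => by
        rw [Real.norm_of_nonneg (by positivity)]; exact (hbd t).2.1)
  set L : Ω → ℝ → ℝ := fun ω t =>
    ‖empiricalFT (fun j : Fin N => Y j ω) t * filterFT g m α t - ft f t‖ ^ 2 with hL
  -- A majorant free of `ω` and integrable in `t`, which justifies Fubini.
  have hLle : ∀ ω t, L ω t ≤ 2 * (‖filterFT g m α t‖ ^ 2 + ‖ft f t‖ ^ 2) := by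
    intro ω t
    have h1 : ‖empiricalFT (fun j : Fin N => Y j ω) t * filterFT g m α t - ft f t‖ ≤
        ‖filterFT g m α t‖ + ‖ft f t‖ := by
      refine (norm_sub_le _ _).trans ?_
      gcongr
      rw [norm_mul]
      exact mul_le_of_le_one_left (norm_nonneg _) (norm_empiricalFT_le _ _)
    calc L ω t ≤ (‖filterFT g m α t‖ + ‖ft f t‖) ^ 2 := by
          simp only [hL]; gcongr
      _ ≤ _ := by nlinarith [sq_nonneg (‖filterFT g m α t‖ - ‖ft f t‖)]
  have hLint : Integrable (Function.uncurry L) (μ.prod volume) := by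
    have hdom : Integrable (fun z : Ω × ℝ =>
        2 * (‖filterFT g m α z.2‖ ^ 2 + ‖ft f z.2‖ ^ 2)) (μ.prod volume) :=
      ((hφsq.add hfsq).const_mul 2).comp_snd μ
    refine hdom.mono' ?_ (Eventually.of_forall fun z => ?_)
    · have := measurable_uncurry_empiricalFT hY N
      have hfm := hcf.measurable
      exact Measurable.aestronglyMeasurable (by
        simp only [hL, Function.uncurry_def]
        fun_prop)
    · rw [Real.norm_of_nonneg (by simp only [hL, Function.uncurry_def]; positivity)]
      exact hLle z.1 z.2
  have hrisk : 2 * Real.pi * risk μ Y f g m α N = ∫ t, ∫ ω, L ω t ∂μ := by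
    rw [risk, ← integral_const_mul, ← integral_integral_swap hLint]
    simp only [loss_eq hf hf2 hg hm hα, hL]
  have hcφ : Measurable fun t => (filterFT g m α t / conj (ft g t)).re :=
    measurable_re_filterFT_div hg m α
  have hvm : AEStronglyMeasurable fun t => ‖ft f t * ft g t‖ ^ 2 :=
    Continuous.aestronglyMeasurable (by fun_prop)
  have hvB : ∀ t, |‖ft f t * ft g t‖ ^ 2| ≤ 1 := fun t => by
    rw [abs_of_nonneg (by positivity)]
    exact pow_le_one₀ (norm_nonneg _) (norm_ft_mul_ft_le hf hg t)
  have i1 : Integrable fun t => ‖filterFT g m α t‖ ^ 2 * ‖ft f t * ft g t‖ ^ 2 :=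
    integrable_mul_of_abs_le_inv_one_add_sq (hmφ.norm.pow_const 2) (fun t => by
      rw [abs_of_nonneg (by positivity)]; exact (hbd t).2.1) hvm hvB
  have i2 : Integrable fun t => (filterFT g m α t / conj (ft g t)).re * ‖ft f t * ft g t‖ ^ 2 :=
    integrable_mul_of_abs_le_inv_one_add_sq hcφ (fun t => (hbd t).2.2) hvm hvB
  have hinner : ∀ t, ∫ ω, L ω t ∂μ =
      ((N : ℝ) - 1) / N * (‖filterFT g m α t‖ ^ 2 * ‖ft f t * ft g t‖ ^ 2)
      - 2 * ((filterFT g m α t / conj (ft g t)).re * ‖ft f t * ft g t‖ ^ 2)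
      + 1 / (N : ℝ) * ‖filterFT g m α t‖ ^ 2 + ‖ft f t‖ ^ 2 := by
    intro t
    simp only [hL]
    rw [integral_norm_empiricalFT_mul_sub_sq hY hindep hN
      (fun j => integral_exp_of_map_eq hf hg (hY j) (hlaw j) t), mul_filterFT_mul_conj_re]
    ring
  rw [surrogateRisk, mul_sub, hrisk, ← integral_norm_ft_sq hf hf2]
  simp only [hinner]
  rw [integral_add (by exact ((i1.const_mul _).sub (i2.const_mul _)).add (hφsq.const_mul _)) hfsq,
    integral_add (by exact (i1.const_mul _).sub (i2.const_mul _)) (hφsq.const_mul _),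
    integral_sub (i1.const_mul _) (i2.const_mul _), integral_const_mul, integral_const_mul,
    integral_const_mul]
  ring

/-! ### Pathwise bound on the error of the criterion. -/

theorem abs_norm_sq_sub_norm_sq_le {z w : ℂ} (hz : ‖z‖ ≤ 1) (hw : ‖w‖ ≤ 1) :
    |‖z‖ ^ 2 - ‖w‖ ^ 2| ≤ 2 * ‖z - w‖ := by
  rw [sq_sub_sq, abs_mul]
  have h1 : |‖z‖ + ‖w‖| ≤ 2 := by
    rw [abs_of_nonneg (by positivity)]
    linarith
  exact mul_le_mul h1 (abs_norm_sub_norm_le z w) (abs_nonneg _) zero_le_two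

/-- The bias correction `H̃_n - |P̃_n|² = (|P̃_n|² - 1)/(n-1)` is at most `1/(n-1) ≤ 2/n` in
modulus; the rest is the Lipschitz bound for `|z|²` on the unit disc. -/
theorem abs_sqModEstimator_sub_le {n : ℕ} (hn : 2 ≤ n) (y : Fin n → ℝ) (t : ℝ) {w : ℂ}
    (hw : ‖w‖ ≤ 1) :
    |sqModEstimator y t - ‖w‖ ^ 2| ≤ 2 / n + 2 * ‖empiricalFT y t - w‖ := by
  have hn' : (2 : ℝ) ≤ n := by exact_mod_cast hn
  have hP := norm_empiricalFT_le y t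
  have hP0 := norm_nonneg (empiricalFT y t)
  have h1 : sqModEstimator y t - ‖empiricalFT y t‖ ^ 2 =
      (‖empiricalFT y t‖ ^ 2 - 1) / ((n : ℝ) - 1) := by
    have : (n : ℝ) - 1 ≠ 0 := by linarith
    rw [sqModEstimator]
    field_simp
    ring
  have h2 : |sqModEstimator y t - ‖empiricalFT y t‖ ^ 2| ≤ 2 / n := by
    rw [h1, abs_div, abs_of_pos (by linarith : (0 : ℝ) < n - 1),
      div_le_div_iff₀ (by linarith) (by linarith)]
    have : |‖empiricalFT y t‖ ^ 2 - 1| ≤ 1 := by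
      rw [abs_le]
      constructor <;> nlinarith
    nlinarith
  calc |sqModEstimator y t - ‖w‖ ^ 2|
      ≤ |sqModEstimator y t - ‖empiricalFT y t‖ ^ 2| + |‖empiricalFT y t‖ ^ 2 - ‖w‖ ^ 2| :=
        abs_sub_le _ _ _
    _ ≤ _ := add_le_add h2 (abs_norm_sq_sub_norm_sq_le hP hw)

/-- Normalizes the weight `(1 + t²)⁻¹` to a probability measure, as Jensen's inequality will
require. -/
theorem integral_cauchyMeasure (v : ℝ → ℝ) :
    ∫ t, v t ∂cauchyMeasure 0 1 = Real.pi⁻¹ * ∫ t, (1 + t ^ 2)⁻¹ * v t := by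
  rw [cauchyMeasure_of_scale_ne_zero 0 one_ne_zero,
    integral_withDensity_eq_integral_toReal_smul (measurable_cauchyPDF 0 1)
      (Eventually.of_forall fun _ => ENNReal.ofReal_lt_top), ← integral_const_mul]
  refine integral_congr_ae (Eventually.of_forall fun t => ?_)
  have : 0 ≤ Real.pi⁻¹ * (1 + t ^ 2)⁻¹ := by positivity
  have h : cauchyPDFReal 0 1 t = Real.pi⁻¹ * (1 + t ^ 2)⁻¹ := by
    simp [cauchyPDFReal_def, add_comm]
  simp only [cauchyPDF_def, h, ENNReal.toReal_ofReal this, smul_eq_mul, mul_assoc]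

/-- The error of the risk criterion is controlled by a weighted `L¹` distance between the
empirical and the true characteristic functions. -/
theorem abs_riskEstimate_sub_surrogateRisk_le {Ω : Type*} [MeasurableSpace Ω] {μ : Measure Ω}
    [IsProbabilityMeasure μ]
    (hf : IsDensity f) (hf2 : MemLp f 2) (hg : IsDensity g) {m : ℕ} (hm : 1 ≤ m)
    {Y : ℕ → Ω → ℝ} (hY : ∀ j, Measurable (Y j)) (hindep : iIndepFun Y μ)
    (hlaw : ∀ j, μ.map (Y j) = volume.withDensity fun y => ENNReal.ofReal (obsDensity f g y))
    {α : ℝ} (hα : 0 < α) {N : ℕ} (hN : N ≠ 0) {K : ℝ}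
    (hK1 : ∀ t, ‖filterFT g m α t‖ ^ 2 ≤ K * (1 + t ^ 2)⁻¹)
    (hK2 : ∀ t, |(filterFT g m α t / conj (ft g t)).re| ≤ K * (1 + t ^ 2)⁻¹)
    {n : ℕ} (hn : 2 ≤ n) (y : Fin n → ℝ) :
    |riskEstimate g m α N y - surrogateRisk μ Y f g m α N| ≤
      6 * Real.pi * K *
        (1 / n + ∫ t, ‖empiricalFT y t - ft f t * ft g t‖ ∂cauchyMeasure 0 1) := by
  have hmφ := measurable_filterFT hg m α
  have hcφ := measurable_re_filterFT_div hg m α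
  have hch : Continuous fun t => ft f t * ft g t := (continuous_ft hf).mul (continuous_ft hg)
  have hcP := continuous_empiricalFT y
  have hcH : Continuous fun t => sqModEstimator y t := by
    unfold sqModEstimator
    fun_prop
  have hh := norm_ft_mul_ft_le hf hg
  set Z : ℝ → ℝ := fun t => ‖empiricalFT y t - ft f t * ft g t‖ with hZ
  have hcZ : Continuous Z := (hcP.sub hch).norm
  have hZ2 : ∀ t, |Z t| ≤ 2 := fun t => by
    rw [hZ, abs_norm]
    exact (norm_sub_le _ _).trans (by linarith [norm_empiricalFT_le y t, hh t])
  have hD : ∀ t, |sqModEstimator y t - ‖ft f t * ft g t‖ ^ 2| ≤ 2 / n + 2 * Z t := fun t =>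
    abs_sqModEstimator_sub_le hn y t (hh t)
  have hn0 : (0 : ℝ) ≤ 2 / n := by positivity
  have hDB : ∀ t, |sqModEstimator y t - ‖ft f t * ft g t‖ ^ 2| ≤ 2 / n + 4 := fun t =>
    (hD t).trans (by linarith [le_of_abs_le (hZ2 t)])
  have hv1 : ∀ t, |‖ft f t * ft g t‖ ^ 2| ≤ 1 := fun t => by
    rw [abs_of_nonneg (by positivity)]
    exact pow_le_one₀ (norm_nonneg _) (hh t)
  have hH : ∀ t, |sqModEstimator y t| ≤ 2 / n + 5 := fun t => by
    have h1 := abs_sub_abs_le_abs_sub (sqModEstimator y t) (‖ft f t * ft g t‖ ^ 2)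
    linarith [hDB t, hv1 t]
  have hK1' : ∀ t, |‖filterFT g m α t‖ ^ 2| ≤ K * (1 + t ^ 2)⁻¹ := fun t => by
    rw [abs_of_nonneg (by positivity)]; exact hK1 t
  have hvm : AEStronglyMeasurable fun t => ‖ft f t * ft g t‖ ^ 2 :=
    (hch.norm.pow 2).aestronglyMeasurable
  have hHm := hcH.aestronglyMeasurable (μ := volume)
  have i1 := integrable_mul_of_abs_le_inv_one_add_sq (hmφ.norm.pow_const 2) hK1' hvm hv1
  have i2 := integrable_mul_of_abs_le_inv_one_add_sq hcφ hK2 hvm hv1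
  have i3 := integrable_mul_of_abs_le_inv_one_add_sq (hmφ.norm.pow_const 2) hK1' hHm hH
  have i4 := integrable_mul_of_abs_le_inv_one_add_sq hcφ hK2 hHm hH
  -- The terms `(1/N) ∫ |φ̃_α|²` coincide and cancel.
  have heq : riskEstimate g m α N y - surrogateRisk μ Y f g m α N =
      ∫ t, (((N : ℝ) - 1) / N * ‖filterFT g m α t‖ ^ 2
        - 2 * (filterFT g m α t / conj (ft g t)).re) *
          (sqModEstimator y t - ‖ft f t * ft g t‖ ^ 2) := by
    have hpt : ∀ t, (((N : ℝ) - 1) / N * ‖filterFT g m α t‖ ^ 2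
        - 2 * (filterFT g m α t / conj (ft g t)).re) *
          (sqModEstimator y t - ‖ft f t * ft g t‖ ^ 2) =
        ((N : ℝ) - 1) / N * (‖filterFT g m α t‖ ^ 2 * sqModEstimator y t
          - ‖filterFT g m α t‖ ^ 2 * ‖ft f t * ft g t‖ ^ 2)
        - 2 * ((filterFT g m α t / conj (ft g t)).re * sqModEstimator y t
          - (filterFT g m α t / conj (ft g t)).re * ‖ft f t * ft g t‖ ^ 2) := fun t => by ring
    simp only [hpt]
    rw [integral_sub (by exact (i3.sub i1).const_mul _) (by exact (i4.sub i2).const_mul _),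
      integral_const_mul, integral_const_mul, integral_sub i3 i1, integral_sub i4 i2,
      surrogateRisk_eq hf hf2 hg hm hY hindep hlaw hα hN, riskEstimate]
    ring
  have hNfrac : |((N : ℝ) - 1) / N| ≤ 1 := by
    have : (1 : ℝ) ≤ N := by exact_mod_cast Nat.one_le_iff_ne_zero.mpr hN
    rw [abs_of_nonneg (div_nonneg (by linarith) (by linarith)), div_le_one (by linarith)]
    linarith
  have hw : ∀ t, |((N : ℝ) - 1) / N * ‖filterFT g m α t‖ ^ 2
        - 2 * (filterFT g m α t / conj (ft g t)).re| ≤ 3 * (K * (1 + t ^ 2)⁻¹) := fun t => by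
    have h1 : |((N : ℝ) - 1) / N * ‖filterFT g m α t‖ ^ 2| ≤ K * (1 + t ^ 2)⁻¹ := by
      rw [abs_mul]
      exact (mul_le_of_le_one_left (abs_nonneg _) hNfrac).trans (hK1' t)
    have h2 : |2 * (filterFT g m α t / conj (ft g t)).re| ≤ 2 * (K * (1 + t ^ 2)⁻¹) := by
      rw [abs_mul, abs_two]
      gcongr
      exact hK2 t
    exact (abs_sub _ _).trans (by linarith)
  have iZ : Integrable fun t => (1 + t ^ 2)⁻¹ * Z t :=
    integrable_inv_one_add_sq.mul_bdd (c := 2) hcZ.aestronglyMeasurable (Eventually.of_forall hZ2)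
  rw [heq, integral_cauchyMeasure]
  -- The factor `6π` is `3 = 1 + 2` from the two weights, `2` from `hD`, and `π` from the mass of
  -- `(1 + t²)⁻¹`.
  calc |∫ t, (((N : ℝ) - 1) / N * ‖filterFT g m α t‖ ^ 2
        - 2 * (filterFT g m α t / conj (ft g t)).re) *
          (sqModEstimator y t - ‖ft f t * ft g t‖ ^ 2)|
      ≤ ∫ t, (6 * K / n * (1 + t ^ 2)⁻¹ + 6 * K * ((1 + t ^ 2)⁻¹ * Z t)) := by
        refine (norm_integral_le_integral_norm _).trans (integral_mono_of_nonneg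
          (Eventually.of_forall fun t => norm_nonneg (_ : ℝ))
          ((integrable_inv_one_add_sq.const_mul _).add (iZ.const_mul _))
          (Eventually.of_forall fun t => ?_))
        simp only [Real.norm_eq_abs, abs_mul]
        calc _ ≤ 3 * (K * (1 + t ^ 2)⁻¹) * (2 / n + 2 * Z t) :=
              mul_le_mul (hw t) (hD t) (abs_nonneg _) ((abs_nonneg _).trans (hw t))
          _ = _ := by simp only [Pi.add_apply]; ring
    _ = _ := by
        rw [integral_add (integrable_inv_one_add_sq.const_mul _) (iZ.const_mul _),
          integral_const_mul, integral_const_mul, integral_univ_inv_one_add_sq]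
        simp only [hZ]
        field_simp

/-! ### Concentration of the empirical characteristic function. -/

section Concentration

variable {Ω : Type*} [MeasurableSpace Ω] {μ : Measure Ω} [IsProbabilityMeasure μ] {Y : ℕ → Ω → ℝ}

/-- Exponential moment bound for a normalized mean of independent variables with values in
`[-1, 1]` and common expectation. -/
theorem integral_exp_abs_mean_sub_le {X : ℕ → Ω → ℝ} (hX : ∀ j, Measurable (X j))
    (hindep : iIndepFun X μ) (hb : ∀ j ω, |X j ω| ≤ 1) {c : ℝ} (hc : ∀ j, ∫ ω, X j ω ∂μ = c)
    {n : ℕ} (hn : n ≠ 0) :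
    Integrable (fun ω => Real.exp (2 * √n * |(1 / n : ℝ) * ∑ j : Fin n, X j ω - c|)) μ ∧
    ∫ ω, Real.exp (2 * √n * |(1 / n : ℝ) * ∑ j : Fin n, X j ω - c|) ∂μ ≤ 2 * Real.exp 2 := by
  have hnpos : (0 : ℝ) < n := by exact_mod_cast Nat.pos_of_ne_zero hn
  have hsq : √(n : ℝ) * √n = n := Real.mul_self_sqrt hnpos.le
  have hspos : 0 < √(n : ℝ) := Real.sqrt_pos.mpr hnpos
  -- Hoeffding's lemma: an interval of length `2` gives variance proxy `1` per variable, hence `n`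
  -- for the sum.
  have hsub : HasSubgaussianMGF (fun ω => ∑ j ∈ Finset.range n, (X j ω - c))
      (∑ j ∈ Finset.range n, 1) μ := by
    refine HasSubgaussianMGF.sum_of_iIndepFun (c := fun _ => 1)
      (hindep.comp (fun _ x => x - c) fun _ => by fun_prop) fun j _ => ?_
    have := hasSubgaussianMGF_of_mem_Icc (μ := μ) (X := X j) (a := -1) (b := 1)
      (hX j).aemeasurable (Eventually.of_forall fun ω => abs_le.mp (hb j ω))
    rw [hc j] at this
    have hone : (‖(1 : ℝ) - -1‖₊ / 2) ^ 2 = 1 := by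
      rw [show (1 : ℝ) - -1 = 2 by norm_num]
      ext
      simp
    rwa [hone] at this
  have hmean : ∀ ω, (1 / n : ℝ) * ∑ j : Fin n, X j ω - c =
      (1 / n : ℝ) * ∑ j ∈ Finset.range n, (X j ω - c) := by
    intro ω
    rw [Finset.sum_sub_distrib, Finset.sum_const, Finset.card_range, nsmul_eq_mul,
      Fin.sum_univ_eq_sum_range (fun j => X j ω) n]
    field_simp
  set T : Ω → ℝ := fun ω => ∑ j ∈ Finset.range n, (X j ω - c) with hT
  have hle : ∀ ω, Real.exp (2 * √n * |(1 / n : ℝ) * ∑ j : Fin n, X j ω - c|) ≤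
      Real.exp (2 / √n * T ω) + Real.exp (-(2 / √n) * T ω) := by
    intro ω
    rw [hmean]
    have h1 : 2 * √(n : ℝ) * |(1 / n : ℝ) * T ω| = |2 / √n * T ω| := by
      rw [abs_mul, abs_mul, abs_of_pos (by positivity : (0 : ℝ) < 1 / n),
        abs_of_pos (by positivity : (0 : ℝ) < 2 / √n)]
      nth_rewrite 2 [← hsq]
      field_simp
    rw [h1, neg_mul]
    exact Real.exp_abs_le _
  -- At `s = ±2/√n` the bound `exp(n s²/2)` equals `exp 2`, independently of `n`; the two signs
  -- together give `2 exp 2`.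
  have hmgf : ∀ s : ℝ, s ^ 2 = 4 / n → mgf T μ s ≤ Real.exp 2 := by
    intro s hs
    refine (hsub.mgf_le s).trans (le_of_eq ?_)
    rw [hs]
    congr 1
    simp
    field_simp
    norm_num
  have hs2 : (2 / √(n : ℝ)) ^ 2 = 4 / n := by
    rw [div_pow, Real.sq_sqrt hnpos.le]; norm_num
  have hint := (hsub.integrable_exp_mul (2 / √n)).add (hsub.integrable_exp_mul (-(2 / √n)))
  have hintegrable :
      Integrable (fun ω => Real.exp (2 * √n * |(1 / n : ℝ) * ∑ j : Fin n, X j ω - c|)) μ :=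
    hint.mono' (Measurable.aestronglyMeasurable (by fun_prop)) (Eventually.of_forall fun ω => by
      rw [Real.norm_of_nonneg (Real.exp_nonneg _)]; exact hle ω)
  refine ⟨hintegrable, ?_⟩
  calc ∫ ω, Real.exp (2 * √n * |(1 / n : ℝ) * ∑ j : Fin n, X j ω - c|) ∂μ
      ≤ ∫ ω, (Real.exp (2 / √n * T ω) + Real.exp (-(2 / √n) * T ω)) ∂μ :=
        integral_mono hintegrable hint hle
    _ = mgf T μ (2 / √n) + mgf T μ (-(2 / √n)) :=
        integral_add (hsub.integrable_exp_mul _) (hsub.integrable_exp_mul _)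
    _ ≤ Real.exp 2 + Real.exp 2 := add_le_add (hmgf _ hs2) (hmgf _ (by rw [neg_sq, hs2]))
    _ = _ := by ring

/-- The modulus is at most the sum of the real and imaginary deviations, and `exp(A/2 + B/2) ≤ (exp
A + exp B)/2` separates these dependent parts. This is why the real-valued bound carries `2√n` in
the exponent. -/
theorem integral_exp_norm_empiricalFT_sub_le (hY : ∀ j, Measurable (Y j)) (hindep : iIndepFun Y μ)
    {n : ℕ} (hn : n ≠ 0) {t : ℝ} {c : ℂ}
    (hc : ∀ j, ∫ ω, Complex.exp (-(Complex.I * t * Y j ω)) ∂μ = c) :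
    ∫ ω, Real.exp (√n * ‖empiricalFT (fun j : Fin n => Y j ω) t - c‖) ∂μ ≤ 2 * Real.exp 2 := by
  set e : ℝ → ℂ := fun x => Complex.exp (-(Complex.I * t * x)) with he
  have hce : Continuous e := continuous_exp_neg_I_mul t
  have hle : ∀ x, ‖e x‖ ≤ 1 := fun x => (norm_exp_neg_I_mul t x).le
  have hre := integral_exp_abs_mean_sub_le (X := fun j ω => (e (Y j ω)).re) (c := c.re)
    (fun j => (Complex.continuous_re.comp hce).measurable.comp (hY j))
    (hindep.comp (fun _ x => (e x).re) fun _ => (Complex.continuous_re.comp hce).measurable)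
    (fun j ω => (Complex.abs_re_le_norm _).trans (hle _))
    (fun j => (integral_re (integrable_exp_neg_I_mul (hY j) t)).trans (by rw [hc]; rfl)) hn
  have him := integral_exp_abs_mean_sub_le (X := fun j ω => (e (Y j ω)).im) (c := c.im)
    (fun j => (Complex.continuous_im.comp hce).measurable.comp (hY j))
    (hindep.comp (fun _ x => (e x).im) fun _ => (Complex.continuous_im.comp hce).measurable)
    (fun j ω => (Complex.abs_im_le_norm _).trans (hle _))
    (fun j => (integral_im (integrable_exp_neg_I_mul (hY j) t)).trans (by rw [hc]; rfl)) hn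
  set A : Ω → ℝ := fun ω => 2 * √n * |(1 / n : ℝ) * ∑ j : Fin n, (e (Y j ω)).re - c.re|
  set B : Ω → ℝ := fun ω => 2 * √n * |(1 / n : ℝ) * ∑ j : Fin n, (e (Y j ω)).im - c.im|
  have hdom : ∀ ω, Real.exp (√n * ‖empiricalFT (fun j : Fin n => Y j ω) t - c‖) ≤
      (Real.exp (A ω) + Real.exp (B ω)) / 2 := by
    intro ω
    have hval : empiricalFT (fun j : Fin n => Y j ω) t =
        ((1 / n : ℝ) : ℂ) * ∑ j : Fin n, e (Y j ω) := by
      simp [empiricalFT, he]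
    have h1 : √n * ‖empiricalFT (fun j : Fin n => Y j ω) t - c‖ ≤ A ω / 2 + B ω / 2 := by
      have := Complex.norm_le_abs_re_add_abs_im (empiricalFT (fun j : Fin n => Y j ω) t - c)
      rw [hval] at this ⊢
      rw [Complex.sub_re, Complex.sub_im, Complex.re_ofReal_mul, Complex.im_ofReal_mul,
        Complex.re_sum, Complex.im_sum] at this
      calc _ ≤ √n * _ := mul_le_mul_of_nonneg_left this (Real.sqrt_nonneg _)
        _ = _ := by simp only [A, B]; ring
    calc _ ≤ Real.exp (A ω / 2 + B ω / 2) := Real.exp_le_exp.mpr h1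
      _ = Real.exp (A ω / 2) * Real.exp (B ω / 2) := Real.exp_add _ _
      _ ≤ (Real.exp (A ω / 2) ^ 2 + Real.exp (B ω / 2) ^ 2) / 2 := by
          nlinarith [sq_nonneg (Real.exp (A ω / 2) - Real.exp (B ω / 2))]
      _ = _ := by
          rw [← Real.exp_nat_mul, ← Real.exp_nat_mul]
          congr 3 <;> · push_cast; ring
  calc _ ≤ ∫ ω, (Real.exp (A ω) + Real.exp (B ω)) / 2 ∂μ :=
        integral_mono_of_nonneg (Eventually.of_forall fun _ => Real.exp_nonneg _)
          ((hre.1.add him.1).div_const 2) (Eventually.of_forall hdom)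
    _ = (∫ ω, Real.exp (A ω) ∂μ + ∫ ω, Real.exp (B ω) ∂μ) / 2 := by
        rw [integral_div, integral_add hre.1 him.1]
    _ ≤ _ := by linarith [hre.2, him.2]

variable (ν : Measure ℝ) [IsProbabilityMeasure ν] {h : ℝ → ℂ}

theorem integrable_exp_norm_empiricalFT_sub (hY : ∀ j, Measurable (Y j)) (hh : Measurable h)
    (hh1 : ∀ t, ‖h t‖ ≤ 1) (n : ℕ) : Integrable (fun z : Ω × ℝ =>
      Real.exp (√n * ‖empiricalFT (fun j : Fin n => Y j z.1) z.2 - h z.2‖)) (μ.prod ν) := by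
  have := measurable_uncurry_empiricalFT hY n
  refine Integrable.of_bound (Measurable.aestronglyMeasurable (by fun_prop)) (Real.exp (√n * 2))
    (Eventually.of_forall fun z => ?_)
  rw [Real.norm_of_nonneg (Real.exp_nonneg _), Real.exp_le_exp]
  gcongr
  exact (norm_sub_le _ _).trans (by
    linarith [norm_empiricalFT_le (fun j : Fin n => Y j z.1) z.2, hh1 z.2])

/-- Jensen's inequality moves the exponential inside the mean over `t`, and Fubini reduces the claim
to the bound at fixed `t`, which is uniform in `t`. -/
theorem lintegral_exp_integral_norm_empiricalFT_sub_le (hY : ∀ j, Measurable (Y j))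
    (hindep : iIndepFun Y μ) (hh : Measurable h) (hh1 : ∀ t, ‖h t‖ ≤ 1)
    (hc : ∀ (t : ℝ) j, ∫ ω, Complex.exp (-(Complex.I * t * Y j ω)) ∂μ = h t) {n : ℕ} (hn : n ≠ 0) :
    ∫⁻ ω, ENNReal.ofReal
      (Real.exp (√n * ∫ t, ‖empiricalFT (fun j : Fin n => Y j ω) t - h t‖ ∂ν)) ∂μ ≤
      ENNReal.ofReal (2 * Real.exp 2) := by
  have hint := integrable_exp_norm_empiricalFT_sub (μ := μ) ν hY hh hh1 n
  have hjensen : ∀ ω, Real.exp (√n * ∫ t, ‖empiricalFT (fun j : Fin n => Y j ω) t - h t‖ ∂ν) ≤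
      ∫ t, Real.exp (√n * ‖empiricalFT (fun j : Fin n => Y j ω) t - h t‖) ∂ν := by
    intro ω
    have hm : Measurable fun t => ‖empiricalFT (fun j : Fin n => Y j ω) t - h t‖ :=
      ((continuous_empiricalFT _).measurable.sub hh).norm
    have hb : ∀ t, ‖empiricalFT (fun j : Fin n => Y j ω) t - h t‖ ≤ 2 := fun t =>
      (norm_sub_le _ _).trans (by linarith [norm_empiricalFT_le (fun j : Fin n => Y j ω) t, hh1 t])
    rw [← integral_const_mul]
    refine convexOn_exp.map_integral_le (f := fun t =>
      √n * ‖empiricalFT (fun j : Fin n => Y j ω) t - h t‖) Real.continuous_exp.continuousOn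
      isClosed_univ (by simp) ?_ ?_
    · exact (Integrable.of_bound hm.aestronglyMeasurable 2
        (Eventually.of_forall fun t => by rw [norm_norm]; exact hb t)).const_mul _
    · refine Integrable.of_bound (hm.const_mul _).exp.aestronglyMeasurable (Real.exp (√n * 2))
        (Eventually.of_forall fun t => ?_)
      simp only [Function.comp]
      rw [Real.norm_of_nonneg (Real.exp_nonneg _), Real.exp_le_exp]
      gcongr
      exact hb t
  calc _ ≤ ∫⁻ ω, ENNReal.ofReal
        (∫ t, Real.exp (√n * ‖empiricalFT (fun j : Fin n => Y j ω) t - h t‖) ∂ν) ∂μ :=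
        lintegral_mono fun ω => ENNReal.ofReal_le_ofReal (hjensen ω)
    _ = ENNReal.ofReal (∫ ω,
        ∫ t, Real.exp (√n * ‖empiricalFT (fun j : Fin n => Y j ω) t - h t‖) ∂ν ∂μ) :=
        (ofReal_integral_eq_lintegral_ofReal hint.integral_prod_left
          (Eventually.of_forall fun ω => integral_nonneg fun t => Real.exp_nonneg _)).symm
    _ ≤ _ := by
        refine ENNReal.ofReal_le_ofReal ?_
        rw [integral_integral_swap hint]
        calc _ ≤ ∫ t, 2 * Real.exp 2 ∂ν :=
              integral_mono_of_nonneg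
                (Eventually.of_forall fun t => integral_nonneg fun ω => Real.exp_nonneg _)
                (integrable_const _) (Eventually.of_forall fun t =>
                  integral_exp_norm_empiricalFT_sub_le hY hindep hn (hc t))
          _ = _ := by simp

/-- Almost surely, the mean distance between the empirical and the true characteristic functions
is eventually at most `2 log n / √n`. -/
theorem ae_eventually_integral_norm_empiricalFT_sub_le (hY : ∀ j, Measurable (Y j))
    (hindep : iIndepFun Y μ) (hh : Measurable h) (hh1 : ∀ t, ‖h t‖ ≤ 1)
    (hc : ∀ (t : ℝ) j, ∫ ω, Complex.exp (-(Complex.I * t * Y j ω)) ∂μ = h t) :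
    ∀ᵐ ω ∂μ, ∀ᶠ n : ℕ in atTop,
      √n * ∫ t, ‖empiricalFT (fun j : Fin n => Y j ω) t - h t‖ ∂ν ≤ 2 * Real.log n := by
  set E : ℕ → Ω → ℝ := fun n ω =>
    Real.exp (√n * ∫ t, ‖empiricalFT (fun j : Fin n => Y j ω) t - h t‖ ∂ν) with hE
  have hEm : ∀ n, Measurable (E n) := by
    intro n
    have h1 : StronglyMeasurable fun ω =>
        ∫ t, ‖empiricalFT (fun j : Fin n => Y j ω) t - h t‖ ∂ν := by
      refine StronglyMeasurable.integral_prod_right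
        (f := fun ω t => ‖empiricalFT (fun j : Fin n => Y j ω) t - h t‖) ?_
      have := measurable_uncurry_empiricalFT hY n
      exact Measurable.stronglyMeasurable (by fun_prop)
    exact (h1.measurable.const_mul _).exp
  have hsum : Summable fun n : ℕ => ((n : ℝ) ^ 2)⁻¹ := Real.summable_nat_pow_inv.mpr one_lt_two
  -- Finite expectation makes the series `∑ n⁻² E n` converge almost surely; its terms then tend to
  -- `0`, so eventually `E n < n²`, and logarithms give `2 log n`.
  have hfin : ∫⁻ ω, ∑' n : ℕ, ENNReal.ofReal (((n : ℝ) ^ 2)⁻¹ * E n ω) ∂μ ≠ ⊤ := by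
    rw [lintegral_tsum fun n => ((hEm n).const_mul _).ennreal_ofReal.aemeasurable]
    have hterm : ∀ n : ℕ, ∫⁻ ω, ENNReal.ofReal (((n : ℝ) ^ 2)⁻¹ * E n ω) ∂μ ≤
        ENNReal.ofReal (((n : ℝ) ^ 2)⁻¹ * (2 * Real.exp 2)) := by
      intro n
      rcases eq_or_ne n 0 with rfl | hn
      · simp
      · rw [ENNReal.ofReal_mul (by positivity)]
        simp only [ENNReal.ofReal_mul (inv_nonneg.mpr (sq_nonneg (n : ℝ)))]
        rw [lintegral_const_mul _ (hEm n).ennreal_ofReal]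
        gcongr
        exact lintegral_exp_integral_norm_empiricalFT_sub_le ν hY hindep hh hh1 hc hn
    refine ne_top_of_le_ne_top ?_ (ENNReal.tsum_le_tsum hterm)
    rw [← ENNReal.ofReal_tsum_of_nonneg (fun n => by positivity) (hsum.mul_right _)]
    exact ENNReal.ofReal_ne_top
  filter_upwards [ae_lt_top' (AEMeasurable.tsum fun n =>
    ((hEm n).const_mul _).ennreal_ofReal.aemeasurable) hfin] with ω hω
  have hlim := ENNReal.tendsto_atTop_zero_of_tsum_ne_top hω.ne
  filter_upwards [hlim.eventually (gt_mem_nhds one_pos), eventually_gt_atTop 0] with n hn hn0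
  have hnpos : (0 : ℝ) < n := by exact_mod_cast hn0
  rw [ENNReal.ofReal_lt_one, inv_mul_lt_iff₀ (by positivity), mul_one] at hn
  have := Real.log_le_log (Real.exp_pos _) hn.le
  rwa [Real.log_exp, Real.log_pow, Nat.cast_ofNat] at this

end Concentration

/-! ### Rates and conclusion. -/

theorem isLittleO_log_mul_rpow_neg_mul {q : ℝ} (hq : 0 < q) (r : ℕ → ℝ) :
    (fun n : ℕ => Real.log n * (n : ℝ) ^ (-(q / 2)) * r n) =o[atTop] r := by
  have h1 : Tendsto (fun n : ℕ => Real.log n * (n : ℝ) ^ (-(q / 2))) atTop (𝓝 0) := by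
    have h := ((isLittleO_log_rpow_atTop (half_pos hq)).comp_tendsto
      tendsto_natCast_atTop_atTop).tendsto_div_nhds_zero
    refine h.congr fun n => ?_
    simp only [Function.comp]
    rw [Real.rpow_neg (Nat.cast_nonneg n), div_eq_mul_inv]
  simpa using ((isLittleO_one_iff ℝ).mpr h1).mul_isBigO (isBigO_refl r atTop)

/-- The rate condition bounds `1 / (√n r b)` by a multiple of `n ^ (-q / 2)`. -/
theorem inv_sqrt_mul_le_of_rate {n x c q : ℝ} (hn : 0 < n) (hc : 0 ≤ c)
    (h : n⁻¹ * (x ^ 2)⁻¹ ≤ c * n ^ (-q)) : (√n * x)⁻¹ ≤ √c * n ^ (-(q / 2)) := by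
  have hsq : (n ^ (-(q / 2))) ^ 2 = n ^ (-q) := by
    rw [← Real.rpow_natCast, ← Real.rpow_mul hn.le]
    congr 1
    push_cast
    ring
  refine le_of_sq_le_sq ?_ (by positivity)
  rw [mul_pow, Real.sq_sqrt hc, hsq, inv_pow, mul_pow, Real.sq_sqrt hn.le, mul_inv]
  exact h

end SPeD

theorem mainTheorem2 {Ω : Type*} [MeasurableSpace Ω] (μ : Measure Ω) [IsProbabilityMeasure μ]
    -- the target density, the error density, and the order of the smoothness penalty
    (f g : ℝ → ℝ) (hf : SPeD.IsDensity f) (hf2 : MemLp f 2) (hg : SPeD.IsDensity g)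
    (m : ℕ) (hm : 1 ≤ m)
    -- an i.i.d. sample from the density `h = g * f`
    (Y : ℕ → Ω → ℝ) (hY : ∀ j, Measurable (Y j)) (hindep : iIndepFun Y μ)
    (hlaw : ∀ j, μ.map (Y j) =
      volume.withDensity fun y => ENNReal.ofReal (SPeD.obsDensity f g y))
    -- the smaller sample sizes, the penalty scale and the rate
    (n₁ : ℕ → ℕ) (hn₁ : ∀ᶠ n in atTop, 1 ≤ n₁ n)
    (b r : ℕ → ℝ) (hb : ∀ᶠ n in atTop, 0 < b (n₁ n)) (hr : ∀ᶠ n in atTop, 0 < r (n₁ n))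
    (M : ℝ) (hbM : ∀ᶠ n in atTop, b (n₁ n) ≤ M)
    (q : ℝ) (hq : 0 < q)
    (hrate : (fun n : ℕ => (n : ℝ)⁻¹ * ((r (n₁ n) * b (n₁ n)) ^ 2)⁻¹)
      =O[atTop] fun n : ℕ => (n : ℝ) ^ (-q))
    -- the penalties `α n i`, for `1 ≤ i ≤ k_n = n ^ p`
    (p : ℝ) (hp : 0 < p) (ι l : ℝ) (hι : 0 < ι) (α : ℕ → ℕ → ℝ)
    (hα : ∀ᶠ n : ℕ in atTop, ∀ i ∈ Finset.Icc 1 ⌊(n : ℝ) ^ p⌋₊,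
      ι * b (n₁ n) ≤ α n i ∧ α n i ≤ l * b (n₁ n)) :
    ∀ᵐ ω ∂μ,
      (fun n : ℕ => ⨆ i : Finset.Icc 1 ⌊(n : ℝ) ^ p⌋₊,
        |SPeD.riskEstimate g m (α n i) (n₁ n) (fun j : Fin n => Y j ω)
          - SPeD.surrogateRisk μ Y f g m (α n i) (n₁ n)|)
      =o[atTop] fun n : ℕ => r (n₁ n) := by
  obtain ⟨C, hC, hCb⟩ := SPeD.exists_one_add_sq_mul_le hg hm hι M
  obtain ⟨c, hc, hcr⟩ := hrate.exists_pos
  have hh : Continuous fun t => SPeD.ft f t * SPeD.ft g t :=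
    (SPeD.continuous_ft hf).mul (SPeD.continuous_ft hg)
  filter_upwards [SPeD.ae_eventually_integral_norm_empiricalFT_sub_le (cauchyMeasure 0 1) hY hindep
    hh.measurable (SPeD.norm_ft_mul_ft_le hf hg)
    (fun t j => SPeD.integral_exp_of_map_eq hf hg (hY j) (hlaw j) t)] with ω hω
  -- The constant is `6π C` from the pathwise bound, times `3` from `hsum`, times `√c` from the rate
  -- hypothesis.
  refine IsBigO.trans_isLittleO (IsBigO.of_bound (18 * Real.pi * C * √c) ?_)
    (SPeD.isLittleO_log_mul_rpow_neg_mul hq fun n => r (n₁ n))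
  filter_upwards [hω, hn₁, hb, hr, hbM, hcr.bound, hα, eventually_ge_atTop 3]
    with n hS hN hbn hrn hbMn hrn' hαn hn3
  have hn3' : (3 : ℝ) ≤ n := by exact_mod_cast hn3
  have hnpos : (0 : ℝ) < n := by linarith
  have hspos : 0 < √(n : ℝ) := Real.sqrt_pos.mpr hnpos
  have hlog : 1 ≤ Real.log n := by
    rw [Real.le_log_iff_exp_le hnpos]
    linarith [Real.exp_one_lt_d9]
  have hrate_n : (√n * (r (n₁ n) * b (n₁ n)))⁻¹ ≤ √c * (n : ℝ) ^ (-(q / 2)) := by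
    refine SPeD.inv_sqrt_mul_le_of_rate hnpos hc.le ?_
    rwa [Real.norm_of_nonneg (by positivity), Real.norm_of_nonneg (by positivity)] at hrn'
  have hsum : 1 / (n : ℝ) + ∫ t, ‖SPeD.empiricalFT (fun j : Fin n => Y j ω) t
      - SPeD.ft f t * SPeD.ft g t‖ ∂cauchyMeasure 0 1 ≤ 3 * Real.log n / √n := by
    -- The bias term is absorbed because `n ≥ 3 > e` gives `log n ≥ 1`.
    have h1 : 1 / (n : ℝ) ≤ Real.log n / √n := by
      have : √(n : ℝ) ≤ n := Real.sqrt_le_iff.mpr ⟨hnpos.le, by nlinarith⟩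
      exact div_le_div₀ (by linarith) hlog hspos this
    rw [← le_div_iff₀' hspos] at hS
    calc _ ≤ Real.log n / √n + 2 * Real.log n / √n := add_le_add h1 hS
      _ = _ := by ring
  rw [Real.norm_of_nonneg (Real.iSup_nonneg fun _ => abs_nonneg _),
    Real.norm_of_nonneg (by positivity)]
  -- The bound to be shown contains neither `i` nor `α n i`, so a single almost sure event serves
  -- all penalties.
  refine Real.iSup_le (fun i => ?_) (by positivity)
  have hαi := hαn i i.2
  have hαpos : 0 < α n i := lt_of_lt_of_le (by positivity) hαi.1
  have hw := fun t => SPeD.filter_weights_le hg m hαpos hbn hC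
    (hCb (b (n₁ n)) (α n i) t hbn hbMn hαi.1)
  calc _ ≤ 6 * Real.pi * (C / b (n₁ n)) * (1 / (n : ℝ) + ∫ t, ‖SPeD.empiricalFT
        (fun j : Fin n => Y j ω) t - SPeD.ft f t * SPeD.ft g t‖ ∂cauchyMeasure 0 1) :=
        SPeD.abs_riskEstimate_sub_surrogateRisk_le hf hf2 hg hm hY hindep hlaw hαpos
          (Nat.one_le_iff_ne_zero.mp hN) (fun t => (hw t).2.1) (fun t => (hw t).2.2) (by omega) _
    _ ≤ 6 * Real.pi * (C / b (n₁ n)) * (3 * Real.log n / √n) := by gcongr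
    -- Multiplying and dividing by `r` exposes the quantity `(√n r b)⁻¹` bounded in `hrate_n`.
    _ = 18 * Real.pi * C * Real.log n * (√n * (r (n₁ n) * b (n₁ n)))⁻¹ * r (n₁ n) := by
        field_simp
        ring
    _ ≤ 18 * Real.pi * C * Real.log n * (√c * (n : ℝ) ^ (-(q / 2))) * r (n₁ n) := by gcongr
    _ = _ := by ring
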